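/- Let $\rho_0$ be a Borel probability measure on $\mathbb{R}$ with $\int_{\mathbb{R}} x^2\,d\rho_0(x)<\infty$, and let $v_0:\mathbb{R}\to\mathbb{R}$ be absolutely continuous on $\mathbb{R}$, i.e. for every $\varepsilon>0$ there is $\delta>0$ such that $\sum_i|v_0(b_i)-v_0(a_i)|<\varepsilon$ for every finite family of non-overlapping intervals $[a_i,b_i]\subset\mathbb{R}$ with $\sum_i(b_i-a_i)<\delta$. Then there is a function $X:\mathbb{R}\times[0,\infty)\to\mathbb{R}$, $(y,t)\mapsto X(y,t)$, such that for every $t\ge 0$ the function $X(t):=X(\cdot,t)$ is Borel measurable and belongs to $L^2(\rho_0)$, the map $t\mapsto X(t)$ is Lipschitz (hence absolutely continuous) from $[0,\infty)$ to $L^2(\rho_0)$, $X(y,0)=y$ for $\rho_0$-a.e. $y$, and $X$ solves the sticky particle flow equation: for Lebesgue-a.e. $t\ge 0$ the derivative $\dot X(t)$ exists in $L^2(\rho_0)$ and $$\dot X(t)=\mathbb{E}_{\rho_0}[v_0\mid X(t)]\qquad \rho_0\text{-a.e.},$$ where the right-hand side is the conditional expectation of $v_0$ with respect to $\rho_0$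 given the $\sigma$-algebra generated by $X(t)$. Moreover: (i) $\int_{\mathbb{R}} v_0^2\,d\rho_0<\infty$, and there is a Lebesgue-null set $N\subset\mathbb{R}$ such that for all $s,t\in[0,\infty)\setminus N$ with $s\le t$, $$\int_{\mathbb{R}}\tfrac12\dot X(t)^2\,d\rho_0\le\int_{\mathbb{R}}\tfrac12\dot X(s)^2\,d\rho_0\le\int_{\mathbb{R}}\tfrac12 v_0^2\,d\rho_0.$$ (ii) For all $t\ge0$ and $y,z\in\operatorname{supp}(\rho_0)$ with $y\le z$, $$0\le X(z,t)-X(y,t)\le z-y+t\int_y^z|v_0'(x)|\,dx.$$ (iii) For all $0<s\le t$ and $y,z\in\operatorname{supp}(\rho_0)$, $$\frac1t|X(y,t)-X(z,t)|\le\frac1s|X(y,s)-X(z,s)|.$$ Here $\operatorname{supp}(\rho_0)=\{y\in\mathbb{R}:\rho_0((y-\delta,y+\delta))>0\text{ for all }\delta>0\}$. -/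

import Mathlib

open MeasureTheory Set

/-- Absolute continuity on `s` of a function of a real variable with values in a (pseudo)metric
space: for every `ε > 0` there is `δ > 0` such that, for every finite family of non-overlapping
compact intervals contained in `s` of total length less than `δ`, the increments of `f` over these
intervals add up to less than `ε`. -/
def IsAbsContOn {E : Type*} [PseudoMetricSpace E] (f : ℝ → E) (s : Set ℝ) : Prop :=
  ∀ ε : ℝ, 0 < ε → ∃ δ : ℝ, 0 < δ ∧ ∀ (n : ℕ) (a b : Fin n → ℝ),
    (∀ i, a i ≤ b i ∧ Icc (a i) (b i) ⊆ s) →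
    (Pairwise fun i j => Disjoint (Ioo (a i) (b i)) (Ioo (a j) (b j))) →
    ∑ i, (b i - a i) < δ → ∑ i, dist (f (a i)) (f (b i)) < ε

/-- `X` solves the sticky particle flow equation `Ẋ(t) = E_{ρ₀}[v₀ | X(t)]` for a.e. `t ≥ 0`.

A solution is an absolutely continuous curve `Xc` from `[0, ∞)` to `L²(ρ₀)`; it comes with a function
`X : ℝ → ℝ → ℝ`, where `X y t` is the position at time `t` of the particle which started at `y`, such
that for each `t ≥ 0` the function `X(·, t)` is Borel and is a representative of `Xc t`.
The time derivative is the (strong) derivative in the Banach space `L²(ρ₀)`, and `E_{ρ₀}[v₀ | X(t)]`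
is the conditional expectation given the σ-algebra generated by `X(·, t)`.
Values at negative times play no role. -/
structure IsStickyParticleFlow (ρ₀ : Measure ℝ) (v₀ : ℝ → ℝ)
    (X : ℝ → ℝ → ℝ) (Xc : ℝ → Lp ℝ 2 ρ₀) : Prop where
  measurable : ∀ t : ℝ, 0 ≤ t → Measurable fun y => X y t
  represents : ∀ t : ℝ, 0 ≤ t → ∀ᵐ y ∂ρ₀, Xc t y = X y t
  absCont : IsAbsContOn Xc (Ici 0)
  flow_eq : ∀ᵐ t : ℝ, 0 ≤ t → DifferentiableAt ℝ Xc t ∧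
    ∀ᵐ y ∂ρ₀, (deriv Xc t) y =
      (condExp (MeasurableSpace.comap (fun z => X z t) (inferInstance : MeasurableSpace ℝ)) ρ₀ v₀) y

/-! The solution is explicit: X(t) is the metric projection in L²(ρ₀) of the free flow f_t = id + t
v₀ onto the closed convex cone of nondecreasing functions. Perturbing X(t) by functions of X(t)
shows that the residual is orthogonal to all of these, so X(t) = E[f_t | X(t)]
(`condExp_eq_of_monoProj_eq`).

Everything else rests on a comparison principle (`monoProj_add_sub_mem`): if g - f is nondecreasing,
so is the projection of g minus that of f. It is proved for step functions, where projecting is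
weighted isotonic regression (`sub_le_sub_of_residuals`), and passes to the limit. Comparing f_t
with w_t(x) = x + t∫₀ˣ|v₀'|, which is its own projection, gives (ii). Comparing s f_t with t f_s,
which differ by (t - s) id, gives (iii).

By (iii), X(t) is a Lipschitz function of X(s) for s ≤ t, so the σ-algebras shrink in time, and V(t)
= E[v₀ | X(t)] is a family of orthogonal projections of v₀ onto decreasing subspaces. Hence ‖V(t)‖²
is nonincreasing, which gives (i), and ‖X(t) - X(s) - (t-s)V(t)‖² ≤ (t-s)²(‖V(s)‖² - ‖V(t)‖²) makes
V(t) the derivative wherever ‖V‖² is continuous, that is, off a countable set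
(`exists_countable_hasDerivAt`). -/

/-! ### The monotone cone and its metric projection. -/

/-- The cone of elements of `L²(ρ)` which are nondecreasing on a set of full measure. -/
def monotoneCone (ρ : Measure ℝ) : Set (Lp ℝ 2 ρ) :=
  {u | ∃ s ∈ ae ρ, MonotoneOn u s}

lemma mem_monotoneCone_of_ae_eq {ρ : Measure ℝ} {u : Lp ℝ 2 ρ} {f : ℝ → ℝ}
    (h : u =ᵐ[ρ] f) (hf : ∃ s ∈ ae ρ, MonotoneOn f s) : u ∈ monotoneCone ρ := by
  obtain ⟨s, hs, hm⟩ := hf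
  refine ⟨s ∩ {x | u x = f x}, Filter.inter_mem hs h, ?_⟩
  rintro x ⟨hx, hx'⟩ y ⟨hy, hy'⟩ hxy
  rw [hx', hy']
  exact hm hx hy hxy

lemma exists_monotoneOn_of_mem {ρ : Measure ℝ} {u : Lp ℝ 2 ρ} {f : ℝ → ℝ}
    (h : u =ᵐ[ρ] f) (hu : u ∈ monotoneCone ρ) : ∃ s ∈ ae ρ, MonotoneOn f s := by
  obtain ⟨s, hs, hm⟩ := hu
  refine ⟨s ∩ {x | u x = f x}, Filter.inter_mem hs h, ?_⟩
  rintro x ⟨hx, hx'⟩ y ⟨hy, hy'⟩ hxy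
  rw [← hx', ← hy']
  exact hm hx hy hxy

lemma zero_mem_monotoneCone (ρ : Measure ℝ) : 0 ∈ monotoneCone ρ :=
  mem_monotoneCone_of_ae_eq (Lp.coeFn_zero ℝ 2 ρ) ⟨univ, Filter.univ_mem, monotoneOn_const⟩

lemma add_mem_monotoneCone {ρ : Measure ℝ} {u v : Lp ℝ 2 ρ} (hu : u ∈ monotoneCone ρ)
    (hv : v ∈ monotoneCone ρ) : u + v ∈ monotoneCone ρ := by
  obtain ⟨s, hs, hm⟩ := hu
  obtain ⟨s', hs', hm'⟩ := hv
  exact mem_monotoneCone_of_ae_eq (Lp.coeFn_add u v) ⟨s ∩ s', Filter.inter_mem hs hs',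
    fun x hx y hy hxy => add_le_add (hm hx.1 hy.1 hxy) (hm' hx.2 hy.2 hxy)⟩

lemma smul_mem_monotoneCone {ρ : Measure ℝ} {u : Lp ℝ 2 ρ} (hu : u ∈ monotoneCone ρ)
    {c : ℝ} (hc : 0 ≤ c) : c • u ∈ monotoneCone ρ := by
  obtain ⟨s, hs, hm⟩ := hu
  exact mem_monotoneCone_of_ae_eq (Lp.coeFn_smul c u) ⟨s, hs,
    fun x hx y hy hxy => mul_le_mul_of_nonneg_left (hm hx hy hxy) hc⟩

lemma convex_monotoneCone (ρ : Measure ℝ) : Convex ℝ (monotoneCone ρ) :=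
  fun _ hu _ hv _ _ ha hb _ =>
    add_mem_monotoneCone (smul_mem_monotoneCone hu ha) (smul_mem_monotoneCone hv hb)

/-- A subsequence converges almost everywhere and inequalities survive pointwise limits. The summand
`w n` converges pointwise and needs no integrability. -/
lemma exists_monotoneOn_of_tendsto {ρ : Measure ℝ} {u : ℕ → Lp ℝ 2 ρ} {v : Lp ℝ 2 ρ}
    {w : ℕ → ℝ → ℝ} {w' : ℝ → ℝ} (huv : Filter.Tendsto u Filter.atTop (nhds v))
    (hw : ∀ x, Filter.Tendsto (fun n => w n x) Filter.atTop (nhds (w' x)))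
    (h : ∀ n, ∃ s ∈ ae ρ, MonotoneOn (fun x => w n x + u n x) s) :
    ∃ s ∈ ae ρ, MonotoneOn (fun x => w' x + v x) s := by
  choose s hs hm using h
  obtain ⟨φ, hφ, hlim⟩ := (tendstoInMeasure_of_tendsto_Lp huv).exists_seq_tendsto_ae
  refine ⟨(⋂ n, s n) ∩ {x | Filter.Tendsto (fun i => u (φ i) x) Filter.atTop (nhds (v x))},
    Filter.inter_mem (countable_iInter_mem.2 hs) hlim, ?_⟩
  rintro x ⟨hx, hx'⟩ y ⟨hy, hy'⟩ hxy
  rw [mem_iInter] at hx hy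
  exact le_of_tendsto_of_tendsto' (((hw x).comp hφ.tendsto_atTop).add hx')
    (((hw y).comp hφ.tendsto_atTop).add hy') fun i => hm (φ i) (hx _) (hy _) hxy

lemma isClosed_monotoneCone (ρ : Measure ℝ) : IsClosed (monotoneCone ρ) := by
  refine IsSeqClosed.isClosed fun u v hu huv => ?_
  obtain ⟨s, hs, hm⟩ := exists_monotoneOn_of_tendsto (w := fun _ _ => 0) (w' := fun _ => 0) huv
    (fun _ => tendsto_const_nhds) (fun n => by simp only [zero_add]; exact hu n)
  exact ⟨s, hs, by simpa using hm⟩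

lemma exists_monoProj (ρ : Measure ℝ) (f : Lp ℝ 2 ρ) :
    ∃ u ∈ monotoneCone ρ, ∀ k ∈ monotoneCone ρ, inner ℝ (f - u) (k - u) ≤ 0 := by
  obtain ⟨u, hu, h⟩ := exists_norm_eq_iInf_of_complete_convex
    ⟨0, zero_mem_monotoneCone ρ⟩ (isClosed_monotoneCone ρ).isComplete (convex_monotoneCone ρ) f
  exact ⟨u, hu, (norm_eq_iInf_iff_real_inner_le_zero (convex_monotoneCone ρ) hu).1 h⟩

/-- The metric projection of `L²(ρ)` onto the cone of nondecreasing functions. -/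
noncomputable def monoProj (ρ : Measure ℝ) (f : Lp ℝ 2 ρ) : Lp ℝ 2 ρ :=
  (exists_monoProj ρ f).choose

lemma monoProj_mem (ρ : Measure ℝ) (f : Lp ℝ 2 ρ) : monoProj ρ f ∈ monotoneCone ρ :=
  (exists_monoProj ρ f).choose_spec.1

lemma inner_sub_monoProj_le {ρ : Measure ℝ} (f : Lp ℝ 2 ρ) {k : Lp ℝ 2 ρ}
    (hk : k ∈ monotoneCone ρ) : inner ℝ (f - monoProj ρ f) (k - monoProj ρ f) ≤ 0 :=
  (exists_monoProj ρ f).choose_spec.2 k hk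

lemma inner_le_zero_of_monoProj_add_mem {ρ : Measure ℝ} (f : Lp ℝ 2 ρ) {h : Lp ℝ 2 ρ}
    (hk : monoProj ρ f + h ∈ monotoneCone ρ) : inner ℝ (f - monoProj ρ f) h ≤ 0 := by
  simpa using inner_sub_monoProj_le f hk

lemma norm_monoProj_sub_le {ρ : Measure ℝ} (f g : Lp ℝ 2 ρ) :
    ‖monoProj ρ f - monoProj ρ g‖ ≤ ‖f - g‖ := by
  set u := monoProj ρ f
  set v := monoProj ρ g
  have h1 : inner ℝ (f - u) (v - u) ≤ 0 := inner_sub_monoProj_le f (monoProj_mem ρ g)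
  have h2 : inner ℝ (g - v) (u - v) ≤ 0 := inner_sub_monoProj_le g (monoProj_mem ρ f)
  have h3 : ‖u - v‖ * ‖u - v‖ ≤ ‖f - g‖ * ‖u - v‖ := by
    refine le_trans ?_ (real_inner_le_norm (f - g) (u - v))
    rw [← real_inner_self_eq_norm_mul_norm]
    have e : inner ℝ (f - g) (u - v) - inner ℝ (u - v) (u - v)
        = - inner ℝ (f - u) (v - u) - inner ℝ (g - v) (u - v) := by
      simp only [inner_sub_left, inner_sub_right]
      ring
    linarith
  rcases (norm_nonneg (u - v)).eq_or_lt with h0 | h0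
  · rw [← h0]; positivity
  · exact le_of_mul_le_mul_right h3 h0

/-- Testing against the projection v alone suffices: ‖v - u‖² is the sum of this inner product and
of the one in the variational inequality for v tested at u. -/
lemma monoProj_eq_of_inner_le {ρ : Measure ℝ} {f u : Lp ℝ 2 ρ} (hu : u ∈ monotoneCone ρ)
    (h : inner ℝ (f - u) (monoProj ρ f - u) ≤ 0) : monoProj ρ f = u := by
  have h1 : inner ℝ (f - monoProj ρ f) (u - monoProj ρ f) ≤ 0 := inner_sub_monoProj_le f hu
  set v := monoProj ρ f
  have h3 : inner ℝ (v - u) (v - u) = inner ℝ (f - u) (v - u) + inner ℝ (f - v) (u - v) := by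
    simp only [inner_sub_left, inner_sub_right]
    ring
  have h4 : inner ℝ (v - u) (v - u) ≤ 0 := by linarith
  rw [real_inner_self_nonpos] at h4
  exact sub_eq_zero.1 h4

lemma monoProj_of_mem {ρ : Measure ℝ} {u : Lp ℝ 2 ρ} (hu : u ∈ monotoneCone ρ) :
    monoProj ρ u = u :=
  monoProj_eq_of_inner_le hu (by simp)

lemma continuous_monoProj (ρ : Measure ℝ) : Continuous (monoProj ρ) :=
  (LipschitzWith.of_dist_le_mul (K := 1) fun f g => by
    simpa [dist_eq_norm] using norm_monoProj_sub_le f g).continuous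

lemma toLp_mem_monotoneCone {ρ : Measure ℝ} {f : ℝ → ℝ} (hf : MemLp f 2 ρ) {s : Set ℝ}
    (hs : s ∈ ae ρ) (hm : MonotoneOn f s) : hf.toLp f ∈ monotoneCone ρ :=
  mem_monotoneCone_of_ae_eq hf.coeFn_toLp ⟨s, hs, hm⟩

lemma inner_eq_integral_of_ae_eq {ρ : Measure ℝ} {u v : Lp ℝ 2 ρ} {f g : ℝ → ℝ}
    (hu : u =ᵐ[ρ] f) (hv : v =ᵐ[ρ] g) : inner ℝ u v = ∫ x, f x * g x ∂ρ := by
  rw [L2.inner_def]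
  refine integral_congr_ae ?_
  filter_upwards [hu, hv] with x hx hy
  simp [hx, hy, mul_comm]

/-! ### Weighted isotonic regression of sequences. -/

/-- Discrete comparison of the primitives of the residuals of two isotonic regressions, the data of
the second exceeding those of the first by a nondecreasing sequence. -/
lemma sum_residual_le {m f g u v : ℕ → ℝ} {N : ℕ} (hm : ∀ i, 0 ≤ m i) (hg : Monotone g)
    (hu : Monotone u)
    (hA : ∀ k, 0 ≤ ∑ i ∈ Finset.range k, m i * (f i - u i))
    (hAN : ∀ k, N ≤ k → ∑ i ∈ Finset.range k, m i * (f i - u i) = 0)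
    (hBN : ∀ k, N ≤ k → ∑ i ∈ Finset.range k, m i * (f i + g i - v i) = 0)
    (hBv : ∀ k, v k < v (k + 1) → ∑ i ∈ Finset.range (k + 1), m i * (f i + g i - v i) = 0)
    (k : ℕ) :
    ∑ i ∈ Finset.range k, m i * (f i + g i - v i) ≤ ∑ i ∈ Finset.range k, m i * (f i - u i) := by
  set A : ℕ → ℝ := fun k => ∑ i ∈ Finset.range k, m i * (f i - u i) with hAdef
  set B : ℕ → ℝ := fun k => ∑ i ∈ Finset.range k, m i * (f i + g i - v i) with hBdef
  have hstep : ∀ k, B (k + 1) - A (k + 1) = B k - A k + m k * (g k + u k - v k) := fun k => by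
    simp only [hAdef, hBdef, Finset.sum_range_succ]; ring
  show B k ≤ A k
  by_contra! hk
  have hex : ∃ k, A k < B k := ⟨k, hk⟩
  classical
  -- At the first index where B exceeds A, the increment g + u - v is positive. From there on B > A
  -- ≥ 0, so B ≠ 0 and v cannot jump up, while g and u are nondecreasing. The excess thus persists
  -- forever, although both primitives vanish from N on.
  set j := Nat.find hex
  have hj : A j < B j := Nat.find_spec hex
  obtain ⟨i, hi⟩ : ∃ i, j = i + 1 := by
    refine Nat.exists_eq_succ_of_ne_zero fun h => ?_
    rw [h] at hj
    simp [hAdef, hBdef] at hj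
  have hi' : B i ≤ A i := not_lt.1 (Nat.find_min hex (m := i) (by omega))
  rw [hi] at hj
  have hei : 0 < g i + u i - v i := by
    have := hstep i
    by_contra! h
    nlinarith [mul_nonneg (hm i) (neg_nonneg.2 h)]
  have hind : ∀ n, A (i + 1 + n) < B (i + 1 + n) ∧ 0 < g (i + n) + u (i + n) - v (i + n) := by
    intro n
    induction n with
    | zero => exact ⟨hj, hei⟩
    | succ n ih =>
      obtain ⟨h1, h2⟩ := ih
      have e : i + 1 + n = i + n + 1 := by ring
      rw [e] at h1
      have hvc : v (i + n + 1) ≤ v (i + n) := by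
        by_contra! h
        have h0 : B (i + n + 1) = 0 := hBv _ h
        have h0' : 0 ≤ A (i + n + 1) := hA _
        linarith
      have hg1 := hg (Nat.le_succ (i + n))
      have hu1 := hu (Nat.le_succ (i + n))
      simp only [Nat.succ_eq_add_one] at hg1 hu1
      have h3 : 0 < g (i + n + 1) + u (i + n + 1) - v (i + n + 1) := by linarith
      refine ⟨?_, h3⟩
      have h4 := hstep (i + n + 1)
      have h5 := mul_nonneg (hm (i + n + 1)) h3.le
      rw [show i + 1 + (n + 1) = i + n + 1 + 1 by ring]
      linarith
  have h1 := (hind N).1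
  have h2 : A (i + 1 + N) = 0 := hAN _ (by omega)
  have h3 : B (i + 1 + N) = 0 := hBN _ (by omega)
  linarith

/-- It suffices to treat consecutive indices i < j of positive weight. If u i = u j, use that v is
nondecreasing. Otherwise u jumps in between, so A = 0 on all of [i+1, j], and 0 ≤ B ≤ A gives B = 0
at both ends. With B ≤ A before i and after j, this yields v i - u i ≤ g i ≤ g j ≤ v j - u j. -/
lemma sub_le_sub_of_residuals {m f g u v : ℕ → ℝ} {N : ℕ} (hm : ∀ i, 0 ≤ m i) (hg : Monotone g)
    (hu : Monotone u)
    (hA : ∀ k, 0 ≤ ∑ i ∈ Finset.range k, m i * (f i - u i))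
    (hAN : ∀ k, N ≤ k → ∑ i ∈ Finset.range k, m i * (f i - u i) = 0)
    (hAu : ∀ k, u k < u (k + 1) → ∑ i ∈ Finset.range (k + 1), m i * (f i - u i) = 0)
    (hv : Monotone v)
    (hB : ∀ k, 0 ≤ ∑ i ∈ Finset.range k, m i * (f i + g i - v i))
    (hBN : ∀ k, N ≤ k → ∑ i ∈ Finset.range k, m i * (f i + g i - v i) = 0)
    (hBv : ∀ k, v k < v (k + 1) → ∑ i ∈ Finset.range (k + 1), m i * (f i + g i - v i) = 0)
    {i j : ℕ} (hij : i < j) (hi : 0 < m i) (hj : 0 < m j) : v i - u i ≤ v j - u j := by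
  have hBA := sum_residual_le hm hg hu hA hAN hBN hBv
  set A : ℕ → ℝ := fun k => ∑ i ∈ Finset.range k, m i * (f i - u i) with hAdef
  set B : ℕ → ℝ := fun k => ∑ i ∈ Finset.range k, m i * (f i + g i - v i) with hBdef
  have hstep : ∀ k, B (k + 1) - A (k + 1) = B k - A k + m k * (g k + u k - v k) := fun k => by
    simp only [hAdef, hBdef, Finset.sum_range_succ]; ring
  replace hBA : ∀ k, B k ≤ A k := hBA
  induction hd : j - i using Nat.strong_induction_on generalizing i j with
  | _ d ih =>
  by_cases hgap : ∃ k, i < k ∧ k < j ∧ 0 < m k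
  · obtain ⟨k, hik, hkj, hk⟩ := hgap
    exact (ih (k - i) (by omega) hik hi hk rfl).trans (ih (j - k) (by omega) hkj hk hj rfl)
  · push Not at hgap
    have hm0 : ∀ k, i < k → k < j → m k = 0 := fun k h1 h2 => le_antisymm (hgap k h1 h2) (hm k)
    rcases (hu hij.le).eq_or_lt with huij | huij
    · have := hv hij.le
      linarith
    have hAc : ∀ n, i + 1 + n ≤ j → A (i + 1 + n) = A (i + 1) := by
      intro n
      induction n with
      | zero => intro _; rfl
      | succ n ihn =>
        intro hn
        rw [← ihn (by omega)]
        show A (i + 1 + n + 1) = _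
        simp only [hAdef]
        rw [Finset.sum_range_succ, hm0 (i + 1 + n) (by omega) (by omega)]
        simp
    obtain ⟨n, hn, hun⟩ : ∃ n, i + n < j ∧ u (i + n) < u (i + n + 1) := by
      by_contra! h
      have : ∀ n, i + n ≤ j → u (i + n) ≤ u i := by
        intro n
        induction n with
        | zero => intro _; rfl
        | succ n ihn => intro hn; exact (h n (by omega)).trans (ihn (by omega))
      have := this (j - i) (by omega)
      rw [show i + (j - i) = j by omega] at this
      linarith
    have hAi : A (i + 1) = 0 := by
      rw [← hAc n (by omega), show i + 1 + n = i + n + 1 by ring]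
      exact hAu _ hun
    have hAj : A j = 0 := by
      rw [← hAi, ← hAc (j - (i + 1)) (by omega)]
      congr 1
      omega
    have h1 := hstep i
    have h2 := hstep j
    have hB1 : 0 ≤ B (i + 1) := hB _
    have hB2 : 0 ≤ B j := hB _
    have h3 : 0 ≤ m i * (g i + u i - v i) := by linarith [hBA i, hBA (i + 1)]
    have h4 : m j * (g j + u j - v j) ≤ 0 := by linarith [hBA j, hBA (j + 1)]
    have h5 : 0 ≤ g i + u i - v i := nonneg_of_mul_nonneg_right h3 hi
    have h6 : g j + u j - v j ≤ 0 := nonpos_of_mul_nonpos_right h4 hj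
    have := hg hij.le
    linarith

/-! ### Projection of step functions. -/

lemma memLp_comp_nat (ρ : Measure ℝ) [IsFiniteMeasure ρ] {q : ℝ → ℕ} (hq : Monotone q) {N : ℕ}
    (hN : ∀ x, q x < N) (φ : ℕ → ℝ) : MemLp (fun x => φ (q x)) 2 ρ := by
  refine MemLp.of_bound ((measurable_of_countable φ).comp hq.measurable).aestronglyMeasurable
    (∑ i ∈ Finset.range N, |φ i|) (Filter.Eventually.of_forall fun x => ?_)
  exact Finset.single_le_sum (f := fun i => |φ i|) (fun i _ => abs_nonneg _)
    (Finset.mem_range.2 (hN x))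

lemma integral_comp_nat_mul {ρ : Measure ℝ} {q : ℝ → ℕ} (hq : Measurable q) {N : ℕ}
    (hN : ∀ x, q x < N) (φ : ℕ → ℝ) {h : ℝ → ℝ} (hh : Integrable h ρ) :
    ∫ x, φ (q x) * h x ∂ρ = ∑ i ∈ Finset.range N, φ i * ∫ x in q ⁻¹' {i}, h x ∂ρ := by
  have hmeas : ∀ i, MeasurableSet (q ⁻¹' {i}) := fun i => hq (measurableSet_singleton i)
  have e : (fun x => φ (q x) * h x)
      = fun x => ∑ i ∈ Finset.range N, (q ⁻¹' {i}).indicator (fun x => φ i * h x) x := by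
    funext x
    rw [Finset.sum_eq_single (q x)]
    · simp
    · intro i _ hi
      have hx : x ∉ q ⁻¹' {i} := fun hx => hi (Eq.symm hx)
      exact indicator_of_notMem hx _
    · intro hx
      exact absurd (Finset.mem_range.2 (hN x)) hx
  rw [e, integral_finsetSum _ fun i _ => (hh.const_mul _).indicator (hmeas i)]
  refine Finset.sum_congr rfl fun i _ => ?_
  rw [integral_indicator (hmeas i), integral_const_mul]

/-- The averages of a nondecreasing function over the level sets of a nondecreasing function extend
to a nondecreasing sequence. -/
lemma exists_monotone_setIntegral_eq {ρ : Measure ℝ} [IsFiniteMeasure ρ] {q : ℝ → ℕ}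
    (hq : Monotone q) (N : ℕ) {u : Lp ℝ 2 ρ} (hu : u ∈ monotoneCone ρ) :
    ∃ a : ℕ → ℝ, Monotone a ∧
      ∀ i < N, ∫ x in q ⁻¹' {i}, u x ∂ρ = a i * ρ.real (q ⁻¹' {i}) := by
  obtain ⟨s, hs, hm⟩ := hu
  have hui : Integrable u ρ := (Lp.memLp u).integrable one_le_two
  have hmeas : ∀ i, MeasurableSet (q ⁻¹' {i}) := fun i =>
    hq.measurable (measurableSet_singleton i)
  set m : ℕ → ℝ := fun i => ρ.real (q ⁻¹' {i}) with hmdef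
  set I : ℕ → ℝ := fun i => ∫ x in q ⁻¹' {i}, u x ∂ρ with hIdef
  have hmono : MonotoneOn (fun i => I i / m i) {i | i < N ∧ 0 < m i} := by
    rintro i ⟨_, hi⟩ j ⟨_, hj⟩ hij
    rcases hij.eq_or_lt with rfl | hij
    · rfl
    have h1 : ∀ y ∈ s, q y = j → I i / m i ≤ u y := by
      intro y hy hyj
      rw [div_le_iff₀ hi]
      have h := setIntegral_mono_on_ae (μ := ρ) (s := q ⁻¹' {i}) (f := u) (g := fun _ => u y)
        hui.integrableOn (integrable_const _).integrableOn (hmeas i) (by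
          filter_upwards [hs] with x hx hxi
          refine hm hx hy ?_
          have hxi' : q x = i := hxi
          exact (hq.reflect_lt (by rw [hxi', hyj]; exact hij)).le)
      rw [setIntegral_const, smul_eq_mul, mul_comm] at h
      exact h
    show I i / m i ≤ I j / m j
    rw [le_div_iff₀ hj]
    have h := setIntegral_mono_on_ae (μ := ρ) (s := q ⁻¹' {j}) (f := fun _ => I i / m i) (g := u)
      (integrable_const _).integrableOn hui.integrableOn (hmeas j) (by
        filter_upwards [hs] with x hx hxj
        exact h1 x hx hxj)
    rw [setIntegral_const, smul_eq_mul, mul_comm] at h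
    exact h
  have hfin : ({i | i < N ∧ 0 < m i} : Set ℕ).Finite :=
    (finite_lt_nat N).subset fun i hi => hi.1
  obtain ⟨a, ha, hae⟩ := hmono.exists_monotone_extension (hfin.image _).bddBelow
    (hfin.image _).bddAbove
  refine ⟨a, ha, fun i hi => ?_⟩
  rcases (measureReal_nonneg (μ := ρ) (s := q ⁻¹' {i})).eq_or_lt with h0 | h0
  · rw [← h0, mul_zero]
    exact setIntegral_measure_zero _ ((measureReal_eq_zero_iff).1 h0.symm)
  · rw [← hae ⟨hi, h0⟩]
    exact (div_mul_cancel₀ _ h0.ne').symm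

/-- Averaging the projection over the cells stays in the cone. The difference between the datum and
these averages is constant on cells, hence orthogonal to the projection minus its averages, so the
averages already are the projection. -/
lemma exists_monoProj_comp_nat {ρ : Measure ℝ} [IsFiniteMeasure ρ] {q : ℝ → ℕ}
    (hq : Monotone q) {N : ℕ} (hN : ∀ x, q x < N) (φ : ℕ → ℝ) {F : Lp ℝ 2 ρ}
    (hF : F =ᵐ[ρ] fun x => φ (q x)) :
    ∃ a : ℕ → ℝ, Monotone a ∧ (monoProj ρ F =ᵐ[ρ] fun x => a (q x)) := by
  obtain ⟨a, ha, hint⟩ := exists_monotone_setIntegral_eq hq N (monoProj_mem ρ F)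
  refine ⟨a, ha, ?_⟩
  have hLa := memLp_comp_nat ρ hq hN a
  have hcoe := hLa.coeFn_toLp
  rw [monoProj_eq_of_inner_le (u := hLa.toLp _)
    (toLp_mem_monotoneCone hLa Filter.univ_mem ((ha.comp hq).monotoneOn _))]
  · exact hcoe
  · refine le_of_eq ?_
    have hu : Integrable (monoProj ρ F) ρ := (Lp.memLp _).integrable one_le_two
    have ha' : Integrable (fun x => a (q x)) ρ := hLa.integrable one_le_two
    have e : inner ℝ (F - hLa.toLp _) (monoProj ρ F - hLa.toLp _)
        = ∫ x, (fun i => φ i - a i) (q x) * (monoProj ρ F x - a (q x)) ∂ρ :=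
      inner_eq_integral_of_ae_eq (by
        filter_upwards [Lp.coeFn_sub F (hLa.toLp _), hF, hcoe] with x h1 h2 h3
        rw [h1, Pi.sub_apply, h2, h3]) (by
        filter_upwards [Lp.coeFn_sub (monoProj ρ F) (hLa.toLp _), hcoe] with x h1 h3
        rw [h1, Pi.sub_apply, h3])
    rw [e, integral_comp_nat_mul hq.measurable hN (fun i => φ i - a i)
      (h := fun x => monoProj ρ F x - a (q x)) (hu.sub ha')]
    refine Finset.sum_eq_zero fun i hi => ?_
    have hmeas : MeasurableSet (q ⁻¹' {i}) := hq.measurable (measurableSet_singleton i)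
    rw [integral_sub hu.integrableOn ha'.integrableOn, hint i (Finset.mem_range.1 hi),
      setIntegral_congr_fun (g := fun _ => a i) hmeas (fun x hx => by
        have : q x = i := hx
        simp [this]), setIntegral_const, smul_eq_mul]
    ring

/-- Optimality conditions, read off from admissible perturbations of a: lowering an initial segment
is always allowed, adding a constant too, and raising an initial segment by the size of the jump of
a at its end keeps a nondecreasing. -/
lemma sum_residual_properties {ρ : Measure ℝ} [IsFiniteMeasure ρ] {q : ℝ → ℕ}
    (hq : Monotone q) {N : ℕ} (hN : ∀ x, q x < N) {φ : ℕ → ℝ} {F : Lp ℝ 2 ρ}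
    (hF : F =ᵐ[ρ] fun x => φ (q x)) {a : ℕ → ℝ} (ha : Monotone a)
    (hFa : monoProj ρ F =ᵐ[ρ] fun x => a (q x)) :
    (∀ k, 0 ≤ ∑ i ∈ Finset.range k, ρ.real (q ⁻¹' {i}) * (φ i - a i)) ∧
    (∀ k, N ≤ k → ∑ i ∈ Finset.range k, ρ.real (q ⁻¹' {i}) * (φ i - a i) = 0) ∧
    (∀ k, a k < a (k + 1) →
      ∑ i ∈ Finset.range (k + 1), ρ.real (q ⁻¹' {i}) * (φ i - a i) = 0) := by
  have key : ∀ χ : ℕ → ℝ, Monotone (fun i => a i + χ i) → ∀ M, N ≤ M →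
      ∑ i ∈ Finset.range M, ρ.real (q ⁻¹' {i}) * (φ i - a i) * χ i ≤ 0 := by
    intro χ hχ M hM
    have hL := memLp_comp_nat ρ hq hN χ
    have h := inner_le_zero_of_monoProj_add_mem F (h := hL.toLp _)
      (mem_monotoneCone_of_ae_eq (f := fun x => a (q x) + χ (q x)) (by
        filter_upwards [Lp.coeFn_add (monoProj ρ F) (hL.toLp _), hFa, hL.coeFn_toLp]
          with x h1 h2 h3
        rw [h1, Pi.add_apply, h2, h3]) ⟨univ, Filter.univ_mem, (hχ.comp hq).monotoneOn _⟩)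
    rw [inner_eq_integral_of_ae_eq (f := fun x => φ (q x) - a (q x)) (by
        filter_upwards [Lp.coeFn_sub F (monoProj ρ F), hF, hFa] with x h1 h2 h3
        rw [h1, Pi.sub_apply, h2, h3]) hL.coeFn_toLp] at h
    have e := integral_comp_nat_mul (ρ := ρ) hq.measurable (fun x => (hN x).trans_le hM)
      (fun i => (φ i - a i) * χ i) (integrable_const (1 : ℝ))
    simp only [mul_one, setIntegral_const, smul_eq_mul] at e
    rw [e] at h
    refine le_trans (le_of_eq (Finset.sum_congr rfl fun i _ => ?_)) h
    ring
  have trunc : ∀ (k M : ℕ) (c : ℝ), k ≤ M →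
      ∑ i ∈ Finset.range M, ρ.real (q ⁻¹' {i}) * (φ i - a i) * (if i < k then c else 0)
        = c * ∑ i ∈ Finset.range k, ρ.real (q ⁻¹' {i}) * (φ i - a i) := by
    intro k M c hk
    rw [Finset.mul_sum, ← Finset.sum_subset (Finset.range_mono hk)]
    · refine Finset.sum_congr rfl fun i hi => ?_
      rw [if_pos (Finset.mem_range.1 hi), mul_comm]
    · intro i _ hi
      rw [if_neg (by simpa using hi), mul_zero]
  have h1 : ∀ k, 0 ≤ ∑ i ∈ Finset.range k, ρ.real (q ⁻¹' {i}) * (φ i - a i) := by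
    intro k
    have h := key (fun i => if i < k then -1 else 0) (fun i j hij => by
      have := ha hij
      dsimp only
      split_ifs <;> linarith) (max N k) (le_max_left _ _)
    rw [trunc k _ (-1) (le_max_right _ _)] at h
    linarith
  refine ⟨h1, fun k hk => le_antisymm ?_ (h1 k), fun k hk => le_antisymm ?_ (h1 (k + 1))⟩
  · have h := key (fun _ => 1) (fun i j hij => by
      have := ha hij
      dsimp only
      linarith) k hk
    simpa using h
  · have h := key (fun i => if i < k + 1 then a (k + 1) - a k else 0) (fun i j hij => by
      have := ha hij
      dsimp only
      split_ifs with hi hj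
      · linarith
      · have h2 := ha (show i ≤ k by omega)
        have h3 := ha (show k + 1 ≤ j by omega)
        linarith
      · omega
      · linarith) (max N (k + 1)) (le_max_left _ _)
    rw [trunc (k + 1) _ _ (le_max_right _ _)] at h
    exact nonpos_of_mul_nonpos_right h (sub_pos.2 hk)

lemma ae_measureReal_level_pos {ρ : Measure ℝ} [IsFiniteMeasure ρ] (q : ℝ → ℕ) :
    ∀ᵐ x ∂ρ, 0 < ρ.real (q ⁻¹' {q x}) := by
  have h : ρ (⋃ i ∈ {i | ρ (q ⁻¹' {i}) = 0}, q ⁻¹' {i}) = 0 :=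
    (measure_biUnion_null_iff (to_countable _)).2 fun i hi => hi
  refine measure_mono_null (fun x hx => ?_) h
  have hx' : ρ.real (q ⁻¹' {q x}) = 0 := le_antisymm (not_lt.1 hx) measureReal_nonneg
  exact mem_biUnion (x := q x) ((measureReal_eq_zero_iff).1 hx') rfl

/-- Adding a nondecreasing step function to a step function increases all the increments of its
projection. -/
lemma monoProj_add_sub_mem_of_comp_nat {ρ : Measure ℝ} [IsFiniteMeasure ρ] {q : ℝ → ℕ}
    (hq : Monotone q) {N : ℕ} (hN : ∀ x, q x < N) {φ γ : ℕ → ℝ} (hγ : Monotone γ)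
    {F G : Lp ℝ 2 ρ} (hF : F =ᵐ[ρ] fun x => φ (q x))
    (hG : G =ᵐ[ρ] fun x => φ (q x) + γ (q x)) :
    monoProj ρ G - monoProj ρ F ∈ monotoneCone ρ := by
  obtain ⟨a, ha, hFa⟩ := exists_monoProj_comp_nat hq hN φ hF
  obtain ⟨b, hb, hGb⟩ := exists_monoProj_comp_nat hq hN (fun i => φ i + γ i) hG
  obtain ⟨a1, a2, a3⟩ := sum_residual_properties hq hN hF ha hFa
  obtain ⟨b1, b2, b3⟩ := sum_residual_properties hq hN (φ := fun i => φ i + γ i) hG hb hGb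
  refine mem_monotoneCone_of_ae_eq (f := fun x => b (q x) - a (q x)) (by
    filter_upwards [Lp.coeFn_sub (monoProj ρ G) (monoProj ρ F), hFa, hGb] with x h1 h2 h3
    rw [h1, Pi.sub_apply, h2, h3]) ⟨_, ae_measureReal_level_pos q, fun x hx y hy hxy => ?_⟩
  rcases (hq hxy).eq_or_lt with h | h
  · simp only [h, le_refl]
  · exact sub_le_sub_of_residuals (fun i => measureReal_nonneg) hγ ha a1 a2 a3 hb b1 b2 b3 h hx hy

/-! ### Approximation by step functions. -/

open Filter Topology

/-- The index of the cell of width `1 / (n + 1)` of `[-n, n]` which contains `x`, after `x` is moved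
to the nearest point of `[-n, n]`. -/
noncomputable def cellIndex (n : ℕ) (x : ℝ) : ℕ :=
  ⌊(max (-(n : ℝ)) (min x n) + n) * (n + 1)⌋₊

/-- The left end point of the cell of index `i`. -/
noncomputable def cellPoint (n i : ℕ) : ℝ := i / (n + 1) - n

lemma monotone_cellIndex (n : ℕ) : Monotone (cellIndex n) := by
  intro x y hxy
  unfold cellIndex
  gcongr

lemma monotone_cellPoint (n : ℕ) : Monotone (cellPoint n) := by
  intro i j hij
  unfold cellPoint
  gcongr

lemma cellIndex_lt (n : ℕ) (x : ℝ) : cellIndex n x < 2 * n * (n + 1) + 1 := by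
  refine Nat.lt_succ_of_le (Nat.floor_le_of_le ?_)
  push_cast
  have : max (-(n : ℝ)) (min x n) ≤ n :=
    max_le (by linarith [(Nat.cast_nonneg n : (0 : ℝ) ≤ n)]) (min_le_right _ _)
  nlinarith [(Nat.cast_nonneg n : (0 : ℝ) ≤ n)]

lemma abs_cellPoint_cellIndex_sub_le (n : ℕ) (x : ℝ) :
    |cellPoint n (cellIndex n x) - max (-(n : ℝ)) (min x n)| ≤ 1 / (n + 1) := by
  unfold cellPoint cellIndex
  set c := max (-(n : ℝ)) (min x n)
  have hc : 0 ≤ c + n := by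
    have : -(n : ℝ) ≤ c := le_max_left _ _
    linarith
  have hn : (0 : ℝ) < n + 1 := by positivity
  have h1 := Nat.floor_le (mul_nonneg hc hn.le)
  have h2 := Nat.lt_floor_add_one ((c + n) * (n + 1))
  have e : (⌊(c + n) * (n + 1)⌋₊ : ℝ) / (n + 1) - n - c
      = (⌊(c + n) * (n + 1)⌋₊ - (c + n) * (n + 1)) / (n + 1) := by
    field_simp
    ring
  rw [e, abs_div, abs_of_pos hn]
  gcongr
  rw [abs_le]
  constructor <;> linarith

lemma abs_cellPoint_cellIndex_le (n : ℕ) (x : ℝ) :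
    |cellPoint n (cellIndex n x)| ≤ |x| + 1 := by
  have h1 := abs_cellPoint_cellIndex_sub_le n x
  have hn0 : (0 : ℝ) ≤ n := Nat.cast_nonneg n
  have h2 : (1 : ℝ) / (n + 1) ≤ 1 := by
    rw [div_le_one (by positivity)]
    linarith
  have h3 : |max (-(n : ℝ)) (min x n)| ≤ |x| := by
    rw [abs_le]
    constructor
    · refine le_max_of_le_right (le_min (neg_abs_le x) (by linarith [abs_nonneg x]))
    · exact max_le (by linarith [abs_nonneg x]) ((min_le_left _ _).trans (le_abs_self x))
  have := abs_sub_abs_le_abs_sub (cellPoint n (cellIndex n x)) (max (-(n : ℝ)) (min x n))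
  linarith

lemma tendsto_cellPoint_cellIndex (x : ℝ) :
    Tendsto (fun n => cellPoint n (cellIndex n x)) atTop (𝓝 x) := by
  rw [tendsto_iff_dist_tendsto_zero]
  refine squeeze_zero' (Eventually.of_forall fun _ => dist_nonneg) ?_
    tendsto_one_div_add_atTop_nhds_zero_nat
  filter_upwards [(tendsto_natCast_atTop_atTop (R := ℝ)).eventually_ge_atTop |x|] with n hn
  have h := abs_cellPoint_cellIndex_sub_le n x
  rw [abs_le] at hn
  rwa [min_eq_left hn.2, max_eq_right hn.1] at h

lemma memLp_two_of_linear_growth {ρ : Measure ℝ} [IsFiniteMeasure ρ]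
    (hρ : Integrable (fun x : ℝ => x ^ 2) ρ) {f : ℝ → ℝ} (hf : Continuous f) {C : ℝ}
    (hC : ∀ x, |f x| ≤ C * (1 + |x|)) : MemLp f 2 ρ := by
  have hid : MemLp (fun x : ℝ => x) 2 ρ :=
    (memLp_two_iff_integrable_sq measurable_id.aestronglyMeasurable).2 hρ
  have hdom : MemLp (fun x : ℝ => 1 + |x|) 2 ρ := by
    simpa only [Real.norm_eq_abs, Pi.add_def] using (memLp_const (1 : ℝ)).add hid.norm
  refine hdom.of_le_mul (c := C) hf.aestronglyMeasurable (Eventually.of_forall fun x => ?_)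
  rw [Real.norm_eq_abs, Real.norm_eq_abs, abs_of_nonneg (a := 1 + |x|) (by positivity)]
  exact hC x

lemma memLp_comp_cell (ρ : Measure ℝ) [IsFiniteMeasure ρ] (f : ℝ → ℝ) (n : ℕ) :
    MemLp (fun x => f (cellPoint n (cellIndex n x))) 2 ρ :=
  memLp_comp_nat ρ (monotone_cellIndex n) (cellIndex_lt n) fun i => f (cellPoint n i)

lemma tendsto_toLp_comp_cell {ρ : Measure ℝ} [IsFiniteMeasure ρ]
    (hρ : Integrable (fun x : ℝ => x ^ 2) ρ) {f : ℝ → ℝ} (hf : Continuous f) {C : ℝ}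
    (hC : ∀ x, |f x| ≤ C * (1 + |x|)) (hL : MemLp f 2 ρ) :
    Tendsto (fun n => (memLp_comp_cell ρ f n).toLp _) atTop (𝓝 (hL.toLp f)) := by
  have hC0 : 0 ≤ C := by
    have := (abs_nonneg _).trans (hC 0)
    simpa using this
  have hid : MemLp (fun x : ℝ => x) 2 ρ :=
    (memLp_two_iff_integrable_sq measurable_id.aestronglyMeasurable).2 hρ
  -- The cell point has modulus at most |x| + 1, so the two values of f are bounded by C(2 + |x|)
  -- and C(1 + |x|).
  have hdom : MemLp (fun x : ℝ => C * (3 + 2 * |x|)) 2 ρ := by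
    simpa only [Real.norm_eq_abs, Pi.add_def] using
      ((memLp_const (3 : ℝ)).add (hid.norm.const_mul 2)).const_mul C
  rw [tendsto_iff_norm_sub_tendsto_zero]
  have hsq : Tendsto (fun n => ∫ x, (f (cellPoint n (cellIndex n x)) - f x) ^ 2 ∂ρ) atTop
      (𝓝 (∫ _, 0 ∂ρ)) := by
    refine tendsto_integral_of_dominated_convergence (fun x => (C * (3 + 2 * |x|)) ^ 2)
      (fun n => ?_) hdom.integrable_sq (fun n => Eventually.of_forall fun x => ?_)
      (Eventually.of_forall fun x => ?_)
    · exact (((memLp_comp_cell ρ f n).sub hL).integrable_sq).aestronglyMeasurable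
    · rw [Real.norm_eq_abs, abs_of_nonneg (sq_nonneg _), sq_le_sq,
        abs_of_nonneg (a := C * (3 + 2 * |x|)) (by positivity)]
      have h1 := hC (cellPoint n (cellIndex n x))
      have h2 := hC x
      have h3 := mul_le_mul_of_nonneg_left (abs_cellPoint_cellIndex_le n x) hC0
      have h4 := abs_sub (f (cellPoint n (cellIndex n x))) (f x)
      linarith
    · have := (((hf.tendsto x).comp (tendsto_cellPoint_cellIndex x)).sub_const (f x)).pow 2
      simpa using this
  rw [integral_zero] at hsq
  have hsqrt := hsq.sqrt
  rw [Real.sqrt_zero] at hsqrt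
  refine hsqrt.congr fun n => ?_
  rw [norm_eq_sqrt_real_inner, ← MemLp.toLp_sub,
    inner_eq_integral_of_ae_eq (MemLp.coeFn_toLp _) (MemLp.coeFn_toLp _)]
  simp [pow_two]

/-! ### The comparison principle for continuous data. -/

/-- Adding a nondecreasing function to the datum increases all the increments of the projection. -/
lemma monoProj_add_sub_mem {ρ : Measure ℝ} [IsFiniteMeasure ρ]
    (hρ : Integrable (fun x : ℝ => x ^ 2) ρ) {f g h : ℝ → ℝ} (hf : Continuous f)
    (hg : Continuous g) (hh : Monotone h) (hfg : ∀ x, g x = f x + h x) {C C' : ℝ}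
    (hC : ∀ x, |f x| ≤ C * (1 + |x|)) (hC' : ∀ x, |g x| ≤ C' * (1 + |x|))
    (hF : MemLp f 2 ρ) (hG : MemLp g 2 ρ) :
    monoProj ρ (hG.toLp g) - monoProj ρ (hF.toLp f) ∈ monotoneCone ρ := by
  have h1 := ((continuous_monoProj ρ).tendsto _).comp (tendsto_toLp_comp_cell hρ hf hC hF)
  have h2 := ((continuous_monoProj ρ).tendsto _).comp (tendsto_toLp_comp_cell hρ hg hC' hG)
  refine (isClosed_monotoneCone ρ).mem_of_tendsto (h2.sub h1) (Eventually.of_forall fun n => ?_)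
  refine monoProj_add_sub_mem_of_comp_nat (monotone_cellIndex n) (cellIndex_lt n)
    (φ := fun i => f (cellPoint n i)) (γ := fun i => h (cellPoint n i))
    (hh.comp (monotone_cellPoint n)) (MemLp.coeFn_toLp _) ?_
  filter_upwards [(memLp_comp_cell ρ g n).coeFn_toLp] with x hx
  rw [hx, hfg]

/-- Comparison of f with the nondecreasing w, which is its own projection. As w is not assumed
square integrable, this is done for the discretizations, and the limit in w is taken pointwise. -/
lemma exists_monotoneOn_sub_monoProj {ρ : Measure ℝ} [IsFiniteMeasure ρ]
    (hρ : Integrable (fun x : ℝ => x ^ 2) ρ) {f w : ℝ → ℝ} (hf : Continuous f)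
    (hw : Continuous w) (hmw : Monotone w) (hwf : Monotone fun x => w x - f x) {C : ℝ}
    (hC : ∀ x, |f x| ≤ C * (1 + |x|)) (hF : MemLp f 2 ρ) :
    ∃ s ∈ ae ρ, MonotoneOn (fun x => w x - monoProj ρ (hF.toLp f) x) s := by
  have h1 := (((continuous_monoProj ρ).tendsto _).comp (tendsto_toLp_comp_cell hρ hf hC hF)).neg
  obtain ⟨s, hs, hm⟩ := exists_monotoneOn_of_tendsto
    (w := fun n x => w (cellPoint n (cellIndex n x))) h1
    (fun x => (hw.tendsto x).comp (tendsto_cellPoint_cellIndex x)) (fun n => by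
      have hW := memLp_comp_cell ρ w n
      have h := monoProj_add_sub_mem_of_comp_nat (ρ := ρ) (monotone_cellIndex n) (cellIndex_lt n)
        (φ := fun i => f (cellPoint n i))
        (γ := fun i => w (cellPoint n i) - f (cellPoint n i))
        (hwf.comp (monotone_cellPoint n)) (memLp_comp_cell ρ f n).coeFn_toLp
        (G := hW.toLp _) (by
          filter_upwards [hW.coeFn_toLp] with x hx
          rw [hx]
          ring)
      rw [monoProj_of_mem (toLp_mem_monotoneCone hW Filter.univ_mem
        ((hmw.comp ((monotone_cellPoint n).comp (monotone_cellIndex n))).monotoneOn _))] at h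
      refine exists_monotoneOn_of_mem ?_ h
      filter_upwards [Lp.coeFn_sub (hW.toLp _) (monoProj ρ ((memLp_comp_cell ρ f n).toLp _)),
        hW.coeFn_toLp, Lp.coeFn_neg (monoProj ρ ((memLp_comp_cell ρ f n).toLp _))] with x h1 h2 h3
      rw [h1, Pi.sub_apply, h2]
      simp only [Function.comp_apply]
      rw [h3, Pi.neg_apply, sub_eq_add_neg])
  refine ⟨s ∩ {x | (-monoProj ρ (hF.toLp f) : Lp ℝ 2 ρ) x = - monoProj ρ (hF.toLp f) x},
    Filter.inter_mem hs (Lp.coeFn_neg _), ?_⟩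
  rintro x ⟨hx, hx'⟩ y ⟨hy, hy'⟩ hxy
  have := hm hx hy hxy
  simp only at this
  rw [hx', hy'] at this
  simpa [sub_eq_add_neg] using this

/-! ### Consequences of absolute continuity on the line. -/

lemma IsAbsContOn.absolutelyContinuousOnInterval {f : ℝ → ℝ} (hf : IsAbsContOn f univ)
    (a b : ℝ) : AbsolutelyContinuousOnInterval f a b := by
  rw [absolutelyContinuousOnInterval_iff]
  intro ε hε
  obtain ⟨δ, hδ, h⟩ := hf ε hε
  refine ⟨δ, hδ, fun E hE hlen => ?_⟩
  have hd := hE.2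
  have key := h E.1 (fun i => min (E.2 i).1 (E.2 i).2) (fun i => max (E.2 i).1 (E.2 i).2)
    (fun i => ⟨min_le_max, subset_univ _⟩) (fun i j hij => by
      have := hd (Finset.mem_coe.2 (Finset.mem_range.2 i.2))
        (Finset.mem_coe.2 (Finset.mem_range.2 j.2)) (fun he => hij (Fin.ext he))
      exact this.mono Ioo_subset_Ioc_self Ioo_subset_Ioc_self) (by
      rw [Finset.sum_range] at hlen
      refine lt_of_eq_of_lt (Finset.sum_congr rfl fun i _ => ?_) hlen
      rw [Real.dist_eq, max_sub_min_eq_abs'])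
  rw [Finset.sum_range]
  refine lt_of_eq_of_lt (Finset.sum_congr rfl fun i _ => ?_) key
  rcases le_total (E.2 i).1 (E.2 i).2 with hle | hle
  · rw [min_eq_left hle, max_eq_right hle]
  · rw [min_eq_right hle, max_eq_left hle, dist_comm]

lemma IsAbsContOn.exists_dist_lt {f : ℝ → ℝ} (hf : IsAbsContOn f univ) {ε : ℝ} (hε : 0 < ε) :
    ∃ δ > 0, ∀ x y : ℝ, dist x y < δ → dist (f x) (f y) < ε := by
  obtain ⟨δ, hδ, h⟩ := hf ε hε
  have hle : ∀ x y : ℝ, x ≤ y → dist x y < δ → dist (f x) (f y) < ε := by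
    intro x y hxy hd
    have := h 1 (fun _ => x) (fun _ => y) (fun _ => ⟨hxy, subset_univ _⟩)
      (fun i j hij => absurd (Subsingleton.elim i j) hij) (by
        rw [dist_comm, Real.dist_eq, abs_of_nonneg (sub_nonneg.2 hxy)] at hd
        simpa using hd)
    simpa using this
  refine ⟨δ, hδ, fun x y hd => ?_⟩
  rcases le_total x y with hxy | hxy
  · exact hle x y hxy hd
  · rw [dist_comm] at hd ⊢
    exact hle y x hxy hd

lemma IsAbsContOn.continuous {f : ℝ → ℝ} (hf : IsAbsContOn f univ) : Continuous f :=
  (Metric.uniformContinuous_iff.2 fun ε hε => by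
    obtain ⟨δ, hδ, h⟩ := hf.exists_dist_lt hε
    exact ⟨δ, hδ, fun {a b} => h a b⟩).continuous

/-- Walk from 0 to x in about 2|x|/δ equal steps shorter than δ; each changes f by less than 1. -/
lemma IsAbsContOn.exists_linear_growth {f : ℝ → ℝ} (hf : IsAbsContOn f univ) :
    ∃ C : ℝ, 0 ≤ C ∧ ∀ x, |f x| ≤ C * (1 + |x|) := by
  obtain ⟨δ, hδ, h⟩ := hf.exists_dist_lt one_pos
  have hn : ∀ (n : ℕ) (x : ℝ), |x| ≤ n * (δ / 2) → |f x| ≤ |f 0| + n := by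
    intro n
    induction n with
    | zero =>
      intro x hx
      have : x = 0 := by simpa using hx
      simp [this]
    | succ n ih =>
      intro x hx
      push_cast at hx ⊢
      have hn1 : (0 : ℝ) < n + 1 := by positivity
      have h1 : |x * (n / (n + 1))| ≤ n * (δ / 2) := by
        rw [abs_mul, abs_of_nonneg (a := (n : ℝ) / (n + 1)) (by positivity)]
        calc |x| * (n / (n + 1)) ≤ ((n + 1) * (δ / 2)) * (n / (n + 1)) := by gcongr
          _ = n * (δ / 2) := by field_simp
      have h2 : dist x (x * (n / (n + 1))) < δ := by
        rw [Real.dist_eq, show x - x * (n / (n + 1)) = x / (n + 1) by field_simp; ring, abs_div,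
          abs_of_pos hn1, div_lt_iff₀ hn1]
        nlinarith
      have h3 := h _ _ h2
      rw [Real.dist_eq] at h3
      have h4 := abs_sub_abs_le_abs_sub (f x) (f (x * (n / (n + 1))))
      linarith [ih _ h1]
  refine ⟨|f 0| + 1 + 2 / δ, by positivity, fun x => ?_⟩
  have h1 := Nat.le_ceil (|x| / (δ / 2))
  have h2 := Nat.ceil_lt_add_one (a := |x| / (δ / 2)) (by positivity)
  have h3 := hn ⌈|x| / (δ / 2)⌉₊ x (by rwa [div_le_iff₀ (by positivity)] at h1)
  have h4 : |x| / (δ / 2) = 2 / δ * |x| := by field_simp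
  have h5 : 0 ≤ |f 0| * |x| := by positivity
  have h6 : 0 ≤ 2 / δ := by positivity
  nlinarith [abs_nonneg x]

lemma IsAbsContOn.intervalIntegrable_abs_deriv {f : ℝ → ℝ} (hf : IsAbsContOn f univ) (a b : ℝ) :
    IntervalIntegrable (fun x => |deriv f x|) volume a b :=
  (hf.absolutelyContinuousOnInterval a b).intervalIntegrable_deriv.abs

lemma IsAbsContOn.abs_sub_le_integral {f : ℝ → ℝ} (hf : IsAbsContOn f univ) {a b : ℝ}
    (hab : a ≤ b) : |f b - f a| ≤ ∫ x in a..b, |deriv f x| := by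
  rw [← (hf.absolutelyContinuousOnInterval a b).integral_deriv_eq_sub]
  exact intervalIntegral.abs_integral_le_integral_abs hab

/-! ### Continuous representatives and passage to the support. -/

/-- A function which is, on a set, monotone with increments dominated by those of a continuous
strictly increasing function, agrees there with a continuous function. -/
lemma exists_continuous_eqOn {w u : ℝ → ℝ} {s : Set ℝ} (hw : Continuous w) (hmw : StrictMono w)
    (hu : MonotoneOn u s) (hwu : MonotoneOn (fun x => w x - u x) s) :
    ∃ Y : ℝ → ℝ, Continuous Y ∧ EqOn Y u s := by
  have hinv : ∀ x, Function.invFun w (w x) = x := Function.leftInverse_invFun hmw.injective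
  have hle : ∀ x ∈ s, ∀ y ∈ s, x ≤ y → |u x - u y| ≤ |w x - w y| := by
    intro x hx y hy hxy
    have h1 := hu hx hy hxy
    have h2 := hwu hx hy hxy
    have h3 := hmw.monotone hxy
    simp only at h2
    rw [abs_of_nonpos (by linarith), abs_of_nonpos (by linarith)]
    linarith
  -- In the variable w, u is 1-Lipschitz, hence extends to the whole line.
  have hlip : LipschitzOnWith 1 (u ∘ Function.invFun w) (w '' s) := by
    refine LipschitzOnWith.of_dist_le_mul ?_
    rintro _ ⟨x, hx, rfl⟩ _ ⟨y, hy, rfl⟩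
    simp only [Function.comp_apply, hinv, NNReal.coe_one, one_mul, Real.dist_eq]
    rcases le_total x y with hxy | hxy
    · exact hle x hx y hy hxy
    · rw [abs_sub_comm, abs_sub_comm (w x)]
      exact hle y hy x hx hxy
  obtain ⟨ψ, hψ, he⟩ := hlip.extend_real
  refine ⟨ψ ∘ w, hψ.continuous.comp hw, fun x hx => ?_⟩
  have := he (mem_image_of_mem w hx)
  simp only [Function.comp_apply, hinv] at this
  exact this.symm

/-- The closure of a set of full measure contains the support, so a closed relation extends to it.
-/
lemma support_prop_of_ae {ρ : Measure ℝ} {s : Set ℝ} (hs : s ∈ ae ρ) {p : ℝ → ℝ → Prop}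
    (hp : IsClosed {z : ℝ × ℝ | p z.1 z.2}) (h : ∀ x ∈ s, ∀ y ∈ s, p x y) :
    ∀ x ∈ ρ.support, ∀ y ∈ ρ.support, p x y := by
  have hsub : ρ.support ⊆ closure s :=
    Measure.support_subset_of_isClosed isClosed_closure (mem_of_superset hs subset_closure)
  intro x hx y hy
  have : closure (s ×ˢ s) ⊆ {z : ℝ × ℝ | p z.1 z.2} :=
    closure_minimal (fun z hz => h z.1 hz.1 z.2 hz.2) hp
  rw [closure_prod_eq] at this
  exact this (show (x, y) ∈ closure s ×ˢ closure s from ⟨hsub hx, hsub hy⟩)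

/-! ### The projection as a conditional expectation. -/

/-- Both Y + χ(Y) and Y - χ(Y)/(L+1) are nondecreasing, the second because the increments of χ are
at most L times those of its argument. The variational inequality therefore holds with both signs.
-/
lemma integral_residual_mul_eq_zero {ρ : Measure ℝ} [IsFiniteMeasure ρ] {f Y : ℝ → ℝ}
    (hf : MemLp f 2 ρ) (hY : Measurable Y) (hfY : monoProj ρ (hf.toLp f) =ᵐ[ρ] Y)
    {χ : ℝ → ℝ} (hχ : Monotone χ) (h0 : ∀ x, 0 ≤ χ x) (h1 : ∀ x, χ x ≤ 1) {L : ℝ} (hL : 0 ≤ L)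
    (hχL : ∀ x y, x ≤ y → χ y - χ x ≤ L * (y - x)) :
    ∫ x, (f x - Y x) * χ (Y x) ∂ρ = 0 := by
  have hc : MemLp (fun x => χ (Y x)) 2 ρ :=
    MemLp.of_bound (hχ.measurable.comp hY).aestronglyMeasurable 1
      (Eventually.of_forall fun x => by
        rw [Real.norm_eq_abs, abs_of_nonneg (h0 _)]
        exact h1 _)
  obtain ⟨s, hs, hm⟩ := exists_monotoneOn_of_mem hfY (monoProj_mem ρ _)
  have key : ∀ c : ℝ, (∀ x y, x ≤ y → x + c * χ x ≤ y + c * χ y) →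
      c * ∫ x, (f x - Y x) * χ (Y x) ∂ρ ≤ 0 := by
    intro c hmc
    have h := inner_le_zero_of_monoProj_add_mem (hf.toLp f) (h := c • hc.toLp _)
      (mem_monotoneCone_of_ae_eq (f := fun x => Y x + c * χ (Y x)) (by
        filter_upwards [Lp.coeFn_add (monoProj ρ (hf.toLp f)) (c • hc.toLp _), hfY,
          Lp.coeFn_smul c (hc.toLp _), hc.coeFn_toLp] with x h1 h2 h3 h4
        rw [h1, Pi.add_apply, h2, h3, Pi.smul_apply, h4, smul_eq_mul])
        ⟨s, hs, fun x hx y hy hxy => hmc _ _ (hm hx hy hxy)⟩)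
    rw [inner_smul_right, inner_eq_integral_of_ae_eq (f := fun x => f x - Y x) (by
        filter_upwards [Lp.coeFn_sub (hf.toLp f) (monoProj ρ (hf.toLp f)), hfY, hf.coeFn_toLp]
          with x h1 h2 h3
        rw [h1, Pi.sub_apply, h2, h3]) hc.coeFn_toLp] at h
    exact h
  have hp := key 1 fun x y hxy => by linarith [hχ hxy]
  have hLp : 0 < 1 / (L + 1) := by positivity
  have hn := key (-(1 / (L + 1))) fun x y hxy => by
    have h2 := hχL x y hxy
    have h3 : 1 / (L + 1) * (χ y - χ x) ≤ y - x := by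
      rw [one_div, inv_mul_le_iff₀ (by positivity)]
      nlinarith
    linarith
  nlinarith

lemma setIntegral_residual_Ioi_eq_zero {ρ : Measure ℝ} [IsFiniteMeasure ρ] {f Y : ℝ → ℝ}
    (hf : MemLp f 2 ρ) (hY : Measurable Y) (hfY : monoProj ρ (hf.toLp f) =ᵐ[ρ] Y) (c : ℝ) :
    ∫ x in Y ⁻¹' Ioi c, (f x - Y x) ∂ρ = 0 := by
  have hYL : MemLp Y 2 ρ := (memLp_congr_ae hfY).1 (Lp.memLp _)
  have hi : Integrable (fun x => f x - Y x) ρ := (hf.sub hYL).integrable one_le_two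
  -- Lipschitz ramps increasing to the indicator of (c, ∞).
  set χ : ℕ → ℝ → ℝ := fun n x => min 1 (max 0 (n * (x - c)))
  have hmono : ∀ n, Monotone (χ n) := fun n x y hxy => by
    simp only [χ]
    gcongr
  have h0 : ∀ n x, 0 ≤ χ n x := fun n x => le_min zero_le_one (le_max_left _ _)
  have h1 : ∀ n x, χ n x ≤ 1 := fun n x => min_le_left _ _
  have hL : ∀ n x y, x ≤ y → χ n y - χ n x ≤ n * (y - x) := by
    intro n x y hxy
    have hnn : (0 : ℝ) ≤ n * (y - x) := mul_nonneg (Nat.cast_nonneg n) (sub_nonneg.2 hxy)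
    have e : (n : ℝ) * (y - c) = n * (x - c) + n * (y - x) := by ring
    simp only [χ, e]
    rw [sub_le_iff_le_add, min_def, min_def, max_def, max_def]
    split_ifs <;> linarith
  have hlim := tendsto_integral_of_dominated_convergence
    (F := fun n x => (f x - Y x) * χ n (Y x))
    (f := (Y ⁻¹' Ioi c).indicator fun x => f x - Y x) (fun x => ‖f x - Y x‖)
    (fun n => hi.aestronglyMeasurable.mul
      ((hmono n).measurable.comp hY).aestronglyMeasurable) hi.norm
    (fun n => Eventually.of_forall fun x => by
      rw [norm_mul, Real.norm_eq_abs (χ n (Y x)), abs_of_nonneg (h0 _ _)]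
      exact mul_le_of_le_one_right (norm_nonneg _) (h1 _ _))
    (Eventually.of_forall fun x => by
      by_cases hx : c < Y x
      · rw [indicator_of_mem (show x ∈ Y ⁻¹' Ioi c from hx)]
        refine tendsto_const_nhds.congr' ?_
        filter_upwards [(tendsto_natCast_atTop_atTop (R := ℝ)).eventually_ge_atTop (1 / (Y x - c))]
          with n hn
        rw [div_le_iff₀ (sub_pos.2 hx)] at hn
        simp only [χ]
        rw [min_eq_left (le_max_of_le_right hn), mul_one]
      · rw [indicator_of_notMem (show x ∉ Y ⁻¹' Ioi c from hx)]
        refine tendsto_const_nhds.congr fun n => ?_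
        simp only [χ]
        rw [max_eq_left (mul_nonpos_of_nonneg_of_nonpos (Nat.cast_nonneg n)
          (sub_nonpos.2 (not_lt.1 hx))), min_eq_right zero_le_one, mul_zero])
  rw [integral_indicator (hY measurableSet_Ioi)] at hlim
  refine tendsto_nhds_unique hlim (tendsto_const_nhds.congr fun n => ?_)
  exact (integral_residual_mul_eq_zero hf hY hfY (hmono n) (h0 n) (h1 n) (Nat.cast_nonneg n)
    (hL n)).symm

lemma setIntegral_residual_eq_zero {ρ : Measure ℝ} [IsFiniteMeasure ρ] {f Y : ℝ → ℝ}
    (hf : MemLp f 2 ρ) (hY : Measurable Y) (hfY : monoProj ρ (hf.toLp f) =ᵐ[ρ] Y) {B : Set ℝ}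
    (hB : MeasurableSet B) : ∫ x in Y ⁻¹' B, (f x - Y x) ∂ρ = 0 := by
  have hYL : MemLp Y 2 ρ := (memLp_congr_ae hfY).1 (Lp.memLp _)
  have hi : Integrable (fun x => f x - Y x) ρ := (hf.sub hYL).integrable one_le_two
  have htot : ∫ x, (f x - Y x) ∂ρ = 0 := by
    simpa using integral_residual_mul_eq_zero hf hY hfY (χ := fun _ => 1) monotone_const
      (fun _ => zero_le_one) (fun _ => le_rfl) (L := 0) le_rfl (by simp)
  induction B, hB using MeasurableSpace.induction_on_inter
    (h_eq := (BorelSpace.measurable_eq (α := ℝ)).trans (borel_eq_generateFrom_Ioi ℝ))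
    (h_inter := isPiSystem_Ioi) with
  | empty => simp
  | basic t ht =>
    obtain ⟨c, rfl⟩ := ht
    exact setIntegral_residual_Ioi_eq_zero hf hY hfY c
  | compl t ht h =>
    have := integral_add_compl (hY ht) hi
    rw [h, htot, zero_add] at this
    exact this
  | iUnion t hd ht h =>
    rw [preimage_iUnion, integral_iUnion (fun i => hY (ht i))
      (fun i j hij => (hd hij).preimage Y) hi.integrableOn]
    simp [h]

lemma condExp_eq_of_monoProj_eq {ρ : Measure ℝ} [IsFiniteMeasure ρ] {f Y : ℝ → ℝ}
    (hf : MemLp f 2 ρ) (hY : Measurable Y) (hfY : monoProj ρ (hf.toLp f) =ᵐ[ρ] Y) :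
    condExp (MeasurableSpace.comap Y inferInstance) ρ f =ᵐ[ρ] Y := by
  have hYL : MemLp Y 2 ρ := (memLp_congr_ae hfY).1 (Lp.memLp _)
  refine (ae_eq_condExp_of_forall_setIntegral_eq hY.comap_le (hf.integrable one_le_two)
    (fun s _ _ => (hYL.integrable one_le_two).integrableOn) ?_
    (comap_measurable Y).stronglyMeasurable.aestronglyMeasurable).symm
  rintro _ ⟨B, hB, rfl⟩ _
  have h := setIntegral_residual_eq_zero hf hY hfY hB
  rw [integral_sub (hf.integrable one_le_two).integrableOn
    (hYL.integrable one_le_two).integrableOn] at h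
  linarith

lemma integral_mul_eq_integral_condExp_mul {ρ : Measure ℝ} [IsFiniteMeasure ρ]
    {m : MeasurableSpace ℝ} (hm : m ≤ Real.measurableSpace) {f h : ℝ → ℝ} (hf : MemLp f 2 ρ)
    (hh : MemLp h 2 ρ) (hhm : AEStronglyMeasurable[m] h ρ) :
    ∫ x, f x * h x ∂ρ = ∫ x, (condExp m ρ f) x * h x ∂ρ := by
  rw [← integral_condExp (f := fun x => f x * h x) hm]
  exact integral_congr_ae (condExp_mul_of_aestronglyMeasurable_right hhm (hf.integrable_mul hh)
    (hf.integrable one_le_two))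

/-! ### Differentiability of the curve, in an abstract Hilbert setting. -/

section HilbertCurve

variable {H : Type*} [NormedAddCommGroup H] [InnerProductSpace ℝ H] {f₀ v₀ : H} {X V : ℝ → H}
  {M : ℝ → Submodule ℝ H}

lemma norm_sq_sub_of_orthogonal (hM : ∀ s t, 0 < s → s ≤ t → M t ≤ M s)
    (hV : ∀ t, 0 < t → V t ∈ M t)
    (hVo : ∀ t, 0 < t → ∀ e ∈ M t, inner ℝ (v₀ - V t) e = 0) {s t : ℝ} (hs : 0 < s)
    (hst : s ≤ t) : ‖V s - V t‖ ^ 2 = ‖V s‖ ^ 2 - ‖V t‖ ^ 2 := by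
  have ht := hs.trans_le hst
  have h1 := hVo s hs _ (hM s t hs hst (hV t ht))
  have h2 := hVo t ht _ (hV t ht)
  rw [inner_sub_left, sub_eq_zero] at h1 h2
  rw [norm_sub_sq_real, ← h1, h2, real_inner_self_eq_norm_sq]
  ring

lemma norm_le_of_orthogonal (hV : ∀ t, 0 < t → V t ∈ M t)
    (hVo : ∀ t, 0 < t → ∀ e ∈ M t, inner ℝ (v₀ - V t) e = 0) {t : ℝ} (ht : 0 < t) :
    ‖V t‖ ^ 2 ≤ ‖v₀‖ ^ 2 := by
  have h2 := hVo t ht _ (hV t ht)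
  rw [inner_sub_left, sub_eq_zero] at h2
  have h3 := norm_sub_sq_real v₀ (V t)
  rw [h2, real_inner_self_eq_norm_sq] at h3
  nlinarith [sq_nonneg ‖v₀ - V t‖]

/-- With D = X t - X s ∈ M s, the variational inequality at t and orthogonality at s give ‖D‖² ≤
(t-s)⟨V s, D⟩, hence ‖D‖ ≤ (t-s)‖V s‖. Orthogonality to V t ∈ M t ≤ M s gives ⟨D, V t⟩ = (t-s)‖V
t‖². Expand the square. -/
lemma norm_sq_increment_sub_le (hM : ∀ s t, 0 < s → s ≤ t → M t ≤ M s)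
    (hX : ∀ t, 0 < t → X t ∈ M t) (hV : ∀ t, 0 < t → V t ∈ M t)
    (hXo : ∀ t, 0 < t → ∀ e ∈ M t, inner ℝ (f₀ + t • v₀ - X t) e = 0)
    (hVo : ∀ t, 0 < t → ∀ e ∈ M t, inner ℝ (v₀ - V t) e = 0)
    (hP : ∀ s t, 0 < s → s ≤ t → inner ℝ (f₀ + t • v₀ - X t) (X s - X t) ≤ 0)
    {s t : ℝ} (hs : 0 < s) (hst : s ≤ t) :
    ‖X t - X s - (t - s) • V t‖ ^ 2 ≤ (t - s) ^ 2 * (‖V s‖ ^ 2 - ‖V t‖ ^ 2) := by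
  have ht := hs.trans_le hst
  set D := X t - X s with hD
  have hDm : D ∈ M s := (M s).sub_mem (hM s t hs hst (hX t ht)) (hX s hs)
  have h1 := hXo s hs _ hDm
  have h2 := hVo s hs _ hDm
  have h3 := hP s t hs hst
  have h4 := hXo t ht _ (hV t ht)
  have h5 := hXo s hs _ (hM s t hs hst (hV t ht))
  have h6 := hVo t ht _ (hV t ht)
  have hXD : X t = X s + D := by rw [hD]; abel
  have h7 : inner ℝ D D ≤ (t - s) * inner ℝ (V s) D := by
    rw [show X s - X t = -D by rw [hD]; abel, hXD] at h3
    simp only [inner_sub_left, inner_add_left, inner_smul_left, inner_neg_right,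
      conj_trivial] at h1 h2 h3
    linear_combination h3 + h1 + (t - s) * h2
  have h8 : inner ℝ D (V t) = (t - s) * ‖V t‖ ^ 2 := by
    rw [← real_inner_self_eq_norm_sq]
    simp only [hD, inner_sub_left, inner_add_left, inner_smul_left, conj_trivial] at h4 h5 h6 ⊢
    linear_combination h5 - h4 + (t - s) * h6
  have h9 : ‖D‖ ^ 2 ≤ (t - s) ^ 2 * ‖V s‖ ^ 2 := by
    have hn := real_inner_le_norm (V s) D
    rw [real_inner_self_eq_norm_sq] at h7
    have h10 : ‖D‖ ^ 2 ≤ ((t - s) * ‖V s‖) * ‖D‖ := by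
      have := mul_le_mul_of_nonneg_left hn (sub_nonneg.2 hst)
      linarith
    have h11 : ‖D‖ ≤ (t - s) * ‖V s‖ := by
      rcases (norm_nonneg D).eq_or_lt with h0 | h0
      · rw [← h0]
        exact mul_nonneg (sub_nonneg.2 hst) (norm_nonneg _)
      · rw [pow_two] at h10
        exact le_of_mul_le_mul_right h10 h0
    rw [← mul_pow]
    exact pow_le_pow_left₀ (norm_nonneg _) h11 2
  rw [norm_sub_sq_real, inner_smul_right, h8, norm_smul, mul_pow, Real.norm_eq_abs, sq_abs]
  linarith

lemma exists_countable_hasDerivAt (hM : ∀ s t, 0 < s → s ≤ t → M t ≤ M s)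
    (hX : ∀ t, 0 < t → X t ∈ M t) (hV : ∀ t, 0 < t → V t ∈ M t)
    (hXo : ∀ t, 0 < t → ∀ e ∈ M t, inner ℝ (f₀ + t • v₀ - X t) e = 0)
    (hVo : ∀ t, 0 < t → ∀ e ∈ M t, inner ℝ (v₀ - V t) e = 0)
    (hP : ∀ s t, 0 < s → s ≤ t → inner ℝ (f₀ + t • v₀ - X t) (X s - X t) ≤ 0) :
    ∃ N : Set ℝ, N.Countable ∧ ∀ t, 0 < t → t ∉ N → HasDerivAt X (V t) t := by
  classical
  -- The value for t ≤ 0 keeps e antitone on the whole line, so that it has countably many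
  -- discontinuities.
  set e : ℝ → ℝ := fun t => if 0 < t then ‖V t‖ ^ 2 else ‖v₀‖ ^ 2 with he
  have hpos : ∀ t, 0 < t → e t = ‖V t‖ ^ 2 := fun t ht => if_pos ht
  have hanti : Antitone e := by
    intro s t hst
    by_cases ht : 0 < t
    · rw [hpos t ht]
      by_cases hs : 0 < s
      · rw [hpos s hs]
        have := norm_sq_sub_of_orthogonal hM hV hVo hs hst
        nlinarith [sq_nonneg ‖V s - V t‖]
      · rw [show e s = _ from if_neg hs]
        exact norm_le_of_orthogonal hV hVo ht
    · rw [show e t = _ from if_neg ht, show e s = _ from if_neg fun h => ht (h.trans_le hst)]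
  refine ⟨_, hanti.countable_not_continuousAt, fun t ht hc => ?_⟩
  have hc : ContinuousAt e t := not_not.1 hc
  have hinc : ∀ a b, 0 < a → a ≤ b →
      ‖X b - X a - (b - a) • V b‖ ≤ (b - a) * √(e a - e b) := by
    intro a b ha hab
    have h := norm_sq_increment_sub_le hM hX hV hXo hVo hP ha hab
    rw [← hpos a ha, ← hpos b (ha.trans_le hab)] at h
    refine (Real.le_sqrt_of_sq_le h).trans (le_of_eq ?_)
    rw [Real.sqrt_mul (sq_nonneg _), Real.sqrt_sq (sub_nonneg.2 hab)]
  have hbound : ∀ s, 0 < s →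
      ‖X s - X t - (s - t) • V t‖ ≤ 2 * √|e s - e t| * ‖s - t‖ := by
    intro s hs
    rcases le_total s t with hst | hst
    · have h := hinc s t hs hst
      have h0 := hanti hst
      rw [abs_of_nonneg (sub_nonneg.2 h0), Real.norm_eq_abs, abs_of_nonpos (sub_nonpos.2 hst),
        show X s - X t - (s - t) • V t = -(X t - X s - (t - s) • V t) by module, norm_neg]
      have := mul_nonneg (sub_nonneg.2 hst) (Real.sqrt_nonneg (e s - e t))
      linarith
    -- To the right of t the estimate involves V s; replacing it by V t costs as much again, whence
    -- the factor 2.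
    · have h := hinc t s ht hst
      have h0 := hanti hst
      have hVn : ‖V s - V t‖ = √(e t - e s) := by
        rw [hpos t ht, hpos s hs, ← norm_sq_sub_of_orthogonal hM hV hVo ht hst,
          Real.sqrt_sq (norm_nonneg _), norm_sub_rev]
      rw [abs_sub_comm, abs_of_nonneg (sub_nonneg.2 h0), Real.norm_eq_abs,
        abs_of_nonneg (sub_nonneg.2 hst), show X s - X t - (s - t) • V t
          = (X s - X t - (s - t) • V s) + (s - t) • (V s - V t) by module]
      refine (norm_add_le _ _).trans ?_
      rw [norm_smul, hVn, Real.norm_eq_abs, abs_of_nonneg (sub_nonneg.2 hst)]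
      linarith
  rw [hasDerivAt_iff_isLittleO, Asymptotics.isLittleO_iff]
  intro c hcpos
  have hlim : Tendsto (fun s => 2 * √|e s - e t|) (𝓝 t) (𝓝 0) := by
    have : Tendsto (fun s => 2 * √|e s - e t|) (𝓝 t) (𝓝 (2 * √|e t - e t|)) :=
      ((hc.tendsto.sub_const _).abs.sqrt).const_mul 2
    simpa using this
  filter_upwards [hlim.eventually_le_const hcpos, lt_mem_nhds ht] with s hs1 hs2
  exact (hbound s hs2).trans (mul_le_mul_of_nonneg_right hs1 (norm_nonneg _))

end HilbertCurve

/-! ### Scaling, nested σ-algebras and bounds on the support. -/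

lemma monoProj_smul {ρ : Measure ℝ} {c : ℝ} (hc : 0 < c) (F : Lp ℝ 2 ρ) :
    monoProj ρ (c • F) = c • monoProj ρ F := by
  refine monoProj_eq_of_inner_le (smul_mem_monotoneCone (monoProj_mem ρ F) hc.le) ?_
  have h := inner_sub_monoProj_le F
    (smul_mem_monotoneCone (monoProj_mem ρ (c • F)) (inv_nonneg.2 hc.le))
  have e : monoProj ρ (c • F) - c • monoProj ρ F
      = c • (c⁻¹ • monoProj ρ (c • F) - monoProj ρ F) := by
    rw [smul_sub, smul_smul, mul_inv_cancel₀ hc.ne', one_smul]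
  rw [e, ← smul_sub, inner_smul_left, inner_smul_right]
  exact mul_nonpos_of_nonneg_of_nonpos hc.le (mul_nonpos_of_nonneg_of_nonpos hc.le h)

/-- A function measurable with respect to `Y` is, up to null sets, measurable with respect to `Z` if
`Y` is a Lipschitz function of `Z` on a set of full measure. -/
lemma aestronglyMeasurable_comap_of_lipschitz {ρ : Measure ℝ} {Y Z : ℝ → ℝ} {s : Set ℝ}
    (hs : s ∈ ae ρ) {L : NNReal} (hYZ : ∀ x ∈ s, ∀ y ∈ s, |Y x - Y y| ≤ L * |Z x - Z y|)
    {g : ℝ → ℝ} (hg : AEStronglyMeasurable[MeasurableSpace.comap Y inferInstance] g ρ) :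
    AEStronglyMeasurable[MeasurableSpace.comap Z inferInstance] g ρ := by
  obtain ⟨g', hg', hgg'⟩ := hg
  obtain ⟨k, hk, rfl⟩ := hg'.exists_eq_measurable_comp
  rcases s.eq_empty_or_nonempty with rfl | ⟨x₀, hx₀⟩
  · refine ⟨fun _ => 0, stronglyMeasurable_const, ?_⟩
    filter_upwards [hs] with x hx using hx.elim
  classical
  -- A section σ of Z over Z(s): Y ∘ σ is Lipschitz there and extends to ψ with Y = ψ ∘ Z on s.
  have hex : ∀ r, ∃ x ∈ s, r ∈ Z '' s → Z x = r := fun r => by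
    by_cases hr : r ∈ Z '' s
    · obtain ⟨x, hx, rfl⟩ := hr
      exact ⟨x, hx, fun _ => rfl⟩
    · exact ⟨x₀, hx₀, fun h => absurd h hr⟩
  choose σ hσ hσZ using hex
  have hlip : LipschitzOnWith L (fun r => Y (σ r)) (Z '' s) := by
    refine LipschitzOnWith.of_dist_le_mul fun a ha b hb => ?_
    have := hYZ _ (hσ a) _ (hσ b)
    rwa [hσZ a ha, hσZ b hb] at this
  obtain ⟨ψ, hψ, he⟩ := hlip.extend_real
  have hYψ : ∀ x ∈ s, Y x = ψ (Z x) := by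
    intro x hx
    rw [← he (mem_image_of_mem Z hx)]
    have h := hYZ x hx _ (hσ (Z x))
    rw [hσZ _ (mem_image_of_mem Z hx), sub_self, abs_zero, mul_zero] at h
    exact sub_eq_zero.1 (abs_nonpos_iff.1 h)
  refine ⟨fun x => k (ψ (Z x)), ?_, ?_⟩
  · exact ((hk.measurable.comp hψ.continuous.measurable).comp (comap_measurable Z)).stronglyMeasurable
  · filter_upwards [hgg', hs] with x hx hxs
    rw [hx, Function.comp_apply, hYψ x hxs]

lemma LipschitzOnWith.isAbsContOn {E : Type*} [PseudoMetricSpace E] {f : ℝ → E} {s : Set ℝ}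
    {L : NNReal} (hf : LipschitzOnWith L f s) : IsAbsContOn f s := by
  intro ε hε
  refine ⟨ε / (L + 1), by positivity, fun n a b hab _ hlen => ?_⟩
  calc ∑ i, dist (f (a i)) (f (b i)) ≤ ∑ i, (L : ℝ) * (b i - a i) := by
        refine Finset.sum_le_sum fun i _ => ?_
        have h := hf.dist_le_mul _ ((hab i).2 (left_mem_Icc.2 (hab i).1)) _
          ((hab i).2 (right_mem_Icc.2 (hab i).1))
        rwa [dist_comm (a i), Real.dist_eq, abs_of_nonneg (sub_nonneg.2 (hab i).1)] at h
    _ = L * ∑ i, (b i - a i) := by rw [Finset.mul_sum]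
    _ ≤ (L + 1) * ∑ i, (b i - a i) := by
        have : 0 ≤ ∑ i, (b i - a i) := Finset.sum_nonneg fun i _ => sub_nonneg.2 (hab i).1
        nlinarith
    _ < ε := by rwa [lt_div_iff₀' (by positivity)] at hlen

lemma increment_bounds_on_support {ρ : Measure ℝ} {Y w : ℝ → ℝ} {s : Set ℝ} (hs : s ∈ ae ρ)
    (hY : Continuous Y) (hw : Continuous w) (hm : MonotoneOn Y s)
    (hwm : MonotoneOn (fun x => w x - Y x) s) {y z : ℝ} (hy : y ∈ ρ.support) (hz : z ∈ ρ.support)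
    (hyz : y ≤ z) : 0 ≤ Y z - Y y ∧ Y z - Y y ≤ w z - w y := by
  have key : ∀ g : ℝ → ℝ, Continuous g → MonotoneOn g s → g y ≤ g z := by
    intro g hg hgm
    -- The product form of monotonicity is a closed relation in (y, z).
    have h := support_prop_of_ae hs (p := fun y z => 0 ≤ (g z - g y) * (z - y))
      (isClosed_le continuous_const (by fun_prop)) (fun y hy z hz => by
        rcases le_total y z with hyz | hyz
        · exact mul_nonneg (sub_nonneg.2 (hgm hy hz hyz)) (sub_nonneg.2 hyz)
        · exact mul_nonneg_of_nonpos_of_nonpos (sub_nonpos.2 (hgm hz hy hyz))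
            (sub_nonpos.2 hyz)) y hy z hz
    rcases hyz.eq_or_lt with rfl | hlt
    · rfl
    · exact sub_nonneg.1 (nonneg_of_mul_nonneg_left h (sub_pos.2 hlt))
  have h1 := key Y hY hm
  have h2 := key _ (hw.sub hY) hwm
  simp only [Pi.sub_apply] at h2
  constructor <;> linarith

/-! ### The sticky particle flow. -/

theorem theorem1p1 (ρ₀ : Measure ℝ) [IsProbabilityMeasure ρ₀]
    (hρ₀ : Integrable (fun x : ℝ => x ^ 2) ρ₀)
    (v₀ : ℝ → ℝ) (hv₀ : IsAbsContOn v₀ Set.univ) :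
    ∃ (X : ℝ → ℝ → ℝ) (Xc : ℝ → Lp ℝ 2 ρ₀),
      -- `X` is a solution of the sticky particle flow equation, Lipschitz as a map into `L²(ρ₀)`
      IsStickyParticleFlow ρ₀ v₀ X Xc ∧
      (∃ L : NNReal, LipschitzOnWith L Xc (Set.Ici 0)) ∧
      -- initial condition
      (∀ᵐ y ∂ρ₀, X y 0 = y) ∧
      -- (i)
      (Integrable (fun x => v₀ x ^ 2) ρ₀ ∧
        ∃ N : Set ℝ, volume N = 0 ∧ ∀ s t : ℝ, s ∉ N → t ∉ N → 0 ≤ s → s ≤ t →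
          ∫ y, (1 / 2 : ℝ) * (deriv Xc t y) ^ 2 ∂ρ₀ ≤ ∫ y, (1 / 2 : ℝ) * (deriv Xc s y) ^ 2 ∂ρ₀ ∧
          ∫ y, (1 / 2 : ℝ) * (deriv Xc s y) ^ 2 ∂ρ₀ ≤ ∫ y, (1 / 2 : ℝ) * v₀ y ^ 2 ∂ρ₀) ∧
      -- (ii)
      (∀ t : ℝ, 0 ≤ t → ∀ y ∈ ρ₀.support, ∀ z ∈ ρ₀.support, y ≤ z →
        0 ≤ X z t - X y t ∧
        X z t - X y t ≤ z - y + t * ∫ x in y..z, |deriv v₀ x|) ∧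
      -- (iii)
      (∀ s t : ℝ, 0 < s → s ≤ t → ∀ y ∈ ρ₀.support, ∀ z ∈ ρ₀.support,
        1 / t * |X y t - X z t| ≤ 1 / s * |X y s - X z s|) := by
  obtain ⟨C, hC0, hC⟩ := hv₀.exists_linear_growth
  have hvc := hv₀.continuous
  have hv : MemLp v₀ 2 ρ₀ := memLp_two_of_linear_growth hρ₀ hvc hC
  have hid : MemLp (fun x : ℝ => x) 2 ρ₀ :=
    memLp_two_of_linear_growth hρ₀ continuous_id (C := 1) fun x => by simp
  set f : ℝ → ℝ → ℝ := fun t x => x + t * v₀ x with hfdef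
  have hfc : ∀ t, Continuous (f t) := fun t => continuous_id.add (hvc.const_mul t)
  have hfg : ∀ t x, |f t x| ≤ (1 + |t| * C) * (1 + |x|) := by
    intro t x
    have h1 := abs_add_le x (t * v₀ x)
    have h2 := mul_le_mul_of_nonneg_left (hC x) (abs_nonneg t)
    rw [abs_mul] at h1
    simp only [hfdef]
    linarith
  have hfL : ∀ t, MemLp (f t) 2 ρ₀ := fun t => memLp_two_of_linear_growth hρ₀ (hfc t) (hfg t)
  set Xc : ℝ → Lp ℝ 2 ρ₀ := fun t => monoProj ρ₀ ((hfL t).toLp (f t)) with hXc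
  have hfLp : ∀ t, (hfL t).toLp (f t) = hid.toLp _ + t • hv.toLp v₀ := by
    intro t
    rw [← MemLp.toLp_const_smul, ← MemLp.toLp_add]
    rfl
  set w : ℝ → ℝ → ℝ := fun t x => x + t * ∫ r in (0 : ℝ)..x, |deriv v₀ r| with hw
  have hwc : ∀ t, Continuous (w t) := fun t => continuous_id.add
    ((intervalIntegral.continuous_primitive hv₀.intervalIntegrable_abs_deriv 0).const_mul t)
  have hwsub : ∀ t x y, w t y - w t x = y - x + t * ∫ r in x..y, |deriv v₀ r| := by
    intro t x y
    rw [← intervalIntegral.integral_interval_sub_left (hv₀.intervalIntegrable_abs_deriv 0 y)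
      (hv₀.intervalIntegrable_abs_deriv 0 x)]
    simp only [hw]
    ring
  have hwm : ∀ t, 0 ≤ t → StrictMono (w t) := by
    intro t ht x y hxy
    have h1 := mul_nonneg ht (intervalIntegral.integral_nonneg (μ := volume) hxy.le
      (f := fun r => |deriv v₀ r|) fun _ _ => abs_nonneg _)
    linarith [hwsub t x y]
  have hwf : ∀ t, 0 ≤ t → Monotone fun x => w t x - f t x := by
    intro t ht x y hxy
    have h1 := mul_le_mul_of_nonneg_left
      ((le_abs_self _).trans (hv₀.abs_sub_le_integral hxy)) ht
    have h2 := hwsub t x y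
    simp only [hfdef]
    linarith
  -- Continuity of the representative lets the almost everywhere bounds reach every point of the
  -- support.
  have hrep : ∀ t, ∃ Y : ℝ → ℝ, 0 ≤ t → Continuous Y ∧ (Xc t =ᵐ[ρ₀] Y) ∧
      ∃ s ∈ ae ρ₀, MonotoneOn Y s ∧ MonotoneOn (fun x => w t x - Y x) s := by
    intro t
    by_cases ht : 0 ≤ t
    · obtain ⟨s₁, hs₁, hm₁⟩ := monoProj_mem ρ₀ ((hfL t).toLp (f t))
      obtain ⟨s₂, hs₂, hm₂⟩ := exists_monotoneOn_sub_monoProj hρ₀ (hfc t) (hwc t)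
        (hwm t ht).monotone (hwf t ht) (hfg t) (hfL t)
      have hs := Filter.inter_mem hs₁ hs₂
      obtain ⟨Y, hYc, hYe⟩ := exists_continuous_eqOn (hwc t) (hwm t ht)
        (hm₁.mono inter_subset_left) (hm₂.mono inter_subset_right)
      refine ⟨Y, fun _ => ⟨hYc, ?_, _, hs, ?_, ?_⟩⟩
      · filter_upwards [hs] with x hx using (hYe hx).symm
      · exact (hm₁.mono inter_subset_left).congr hYe.symm
      · refine (hm₂.mono inter_subset_right).congr fun x hx => ?_
        simp only [hYe hx]
    · exact ⟨0, fun h => absurd h ht⟩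
  choose Y hY using hrep
  have hYm : ∀ t, 0 ≤ t → Measurable (Y t) := fun t ht => (hY t ht).1.measurable
  have hstick : ∀ s t, 0 < s → s ≤ t → ∃ S ∈ ae ρ₀, ∀ y ∈ S, ∀ z ∈ S,
      s * |Y t y - Y t z| ≤ t * |Y s y - Y s z| := by
    intro s t hs hst
    have ht := hs.trans_le hst
    obtain ⟨_, hYs, S₁, hS₁, hm₁, -⟩ := hY s hs.le
    obtain ⟨_, hYt, S₂, hS₂, hm₂, -⟩ := hY t ht.le
    have hsm := (hfL t).const_smul s
    have htm := (hfL s).const_smul t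
    -- The velocity cancels in t f_s - s f_t = (t - s) id; homogeneity then makes t X(s) - s X(t)
    -- nondecreasing.
    have hmem := monoProj_add_sub_mem hρ₀ (f := s • f t) (g := t • f s)
      (h := fun x => (t - s) * x) ((hfc t).const_smul s) ((hfc s).const_smul t)
      (fun x y hxy => mul_le_mul_of_nonneg_left hxy (sub_nonneg.2 hst))
      (fun x => by simp only [hfdef, Pi.smul_apply, smul_eq_mul]; ring)
      (C := s * (1 + |t| * C)) (C' := t * (1 + |s| * C))
      (fun x => by
        rw [Pi.smul_apply, smul_eq_mul, abs_mul, abs_of_pos hs, mul_assoc]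
        exact mul_le_mul_of_nonneg_left (hfg t x) hs.le)
      (fun x => by
        rw [Pi.smul_apply, smul_eq_mul, abs_mul, abs_of_pos ht, mul_assoc]
        exact mul_le_mul_of_nonneg_left (hfg s x) ht.le) hsm htm
    rw [MemLp.toLp_const_smul t (hfL s), MemLp.toLp_const_smul s (hfL t), monoProj_smul hs, monoProj_smul ht] at hmem
    obtain ⟨S, hS, hm⟩ := exists_monotoneOn_of_mem (f := fun x => t * Y s x - s * Y t x) (by
      filter_upwards [hYs, hYt, Lp.coeFn_sub (t • Xc s) (s • Xc t), Lp.coeFn_smul t (Xc s),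
        Lp.coeFn_smul s (Xc t)] with x h1 h2 h3 h4 h5
      rw [h3, Pi.sub_apply, h4, h5, Pi.smul_apply, Pi.smul_apply, h1, h2, smul_eq_mul,
        smul_eq_mul]) hmem
    have hle : ∀ y ∈ S ∩ (S₁ ∩ S₂), ∀ z ∈ S ∩ (S₁ ∩ S₂), y ≤ z →
        s * |Y t y - Y t z| ≤ t * |Y s y - Y s z| := by
      intro y hy z hz hyz
      have h1 := hm hy.1 hz.1 hyz
      have h2 := hm₁ hy.2.1 hz.2.1 hyz
      have h3 := hm₂ hy.2.2 hz.2.2 hyz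
      simp only at h1
      rw [abs_of_nonpos (by linarith), abs_of_nonpos (by linarith)]
      linarith
    refine ⟨S ∩ (S₁ ∩ S₂), Filter.inter_mem hS (Filter.inter_mem hS₁ hS₂), fun y hy z hz => ?_⟩
    rcases le_total y z with hyz | hyz
    · exact hle y hy z hz hyz
    · rw [abs_sub_comm, abs_sub_comm (Y s y)]
      exact hle z hz y hy hyz
  set V : ℝ → Lp ℝ 2 ρ₀ := fun t =>
    (hv.condExp one_le_two (m := MeasurableSpace.comap (Y t) inferInstance)).toLp _ with hV
  set M : ℝ → Submodule ℝ (Lp ℝ 2 ρ₀) := fun t =>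
    lpMeas ℝ ℝ (MeasurableSpace.comap (Y t) inferInstance) 2 ρ₀ with hMdef
  have hM : ∀ s t, 0 < s → s ≤ t → M t ≤ M s := by
    intro s t hs hst g hg
    obtain ⟨S, hS, h⟩ := hstick s t hs hst
    refine mem_lpMeas_iff_aestronglyMeasurable.2 (aestronglyMeasurable_comap_of_lipschitz hS
      (L := ⟨t / s, div_nonneg (hs.le.trans hst) hs.le⟩) (fun y hy z hz => ?_)
      (mem_lpMeas_iff_aestronglyMeasurable.1 hg))
    show _ ≤ t / s * _
    rw [div_mul_eq_mul_div, le_div_iff₀' hs]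
    exact h y hy z hz
  have hXM : ∀ t, 0 < t → Xc t ∈ M t := by
    intro t ht
    refine mem_lpMeas_iff_aestronglyMeasurable.2 ⟨Y t, ?_, (hY t ht.le).2.1⟩
    exact (comap_measurable (Y t)).stronglyMeasurable
  have hVM : ∀ t, 0 < t → V t ∈ M t := fun t _ =>
    mem_lpMeas_iff_aestronglyMeasurable.2 ⟨_, stronglyMeasurable_condExp, MemLp.coeFn_toLp _⟩
  have horth : ∀ t, 0 < t → ∀ (g : ℝ → ℝ) (hg : MemLp g 2 ρ₀) (G : Lp ℝ 2 ρ₀),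
      G =ᵐ[ρ₀] condExp (MeasurableSpace.comap (Y t) inferInstance) ρ₀ g →
      ∀ e ∈ M t, inner ℝ (hg.toLp g - G) e = 0 := by
    intro t ht g hg G hG e he
    rw [inner_sub_left, sub_eq_zero, inner_eq_integral_of_ae_eq hg.coeFn_toLp ae_eq_rfl,
      inner_eq_integral_of_ae_eq hG ae_eq_rfl]
    exact integral_mul_eq_integral_condExp_mul (hYm t ht.le).comap_le hg (Lp.memLp e)
      (mem_lpMeas_iff_aestronglyMeasurable.1 he)
  have hVo : ∀ t, 0 < t → ∀ e ∈ M t, inner ℝ (hv.toLp v₀ - V t) e = 0 := fun t ht =>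
    horth t ht v₀ hv (V t) (MemLp.coeFn_toLp _)
  have hXo : ∀ t, 0 < t → ∀ e ∈ M t, inner ℝ (hid.toLp _ + t • hv.toLp v₀ - Xc t) e = 0 := by
    intro t ht
    rw [← hfLp]
    exact horth t ht (f t) (hfL t) (Xc t) ((hY t ht.le).2.1.trans
      (condExp_eq_of_monoProj_eq (hfL t) (hYm t ht.le) (hY t ht.le).2.1).symm)
  have hP : ∀ s t, 0 < s → s ≤ t →
      inner ℝ (hid.toLp _ + t • hv.toLp v₀ - Xc t) (Xc s - Xc t) ≤ 0 := by
    intro s t _ _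
    rw [← hfLp]
    exact inner_sub_monoProj_le _ (monoProj_mem ρ₀ _)
  obtain ⟨N, hN, hderiv⟩ := exists_countable_hasDerivAt hM hXM hVM hXo hVo hP
  have hlip : LipschitzOnWith ‖hv.toLp v₀‖₊ Xc (Ici 0) := by
    refine LipschitzOnWith.of_dist_le_mul fun s _ t _ => ?_
    rw [dist_eq_norm]
    refine (norm_monoProj_sub_le _ _).trans (le_of_eq ?_)
    rw [hfLp, hfLp, add_sub_add_left_eq_sub, ← sub_smul, norm_smul, Real.dist_eq, coe_nnnorm,
      Real.norm_eq_abs, mul_comm]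
  -- Time 0 is discarded because the derivative is identified only for t > 0.
  have hN0 : volume (N ∪ {0}) = 0 := (hN.union (countable_singleton 0)).measure_zero volume
  have hnorm : ∀ G : Lp ℝ 2 ρ₀, ∀ g : ℝ → ℝ, G =ᵐ[ρ₀] g →
      ∫ y, (1 / 2 : ℝ) * g y ^ 2 ∂ρ₀ = 1 / 2 * ‖G‖ ^ 2 := by
    intro G g hG
    rw [integral_const_mul, ← real_inner_self_eq_norm_sq, inner_eq_integral_of_ae_eq hG hG]
    simp only [pow_two]
  refine ⟨fun y t => Y t y, Xc, ⟨hYm, fun t ht => (hY t ht).2.1, hlip.isAbsContOn, ?_⟩,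
    ⟨_, hlip⟩, ?_, ⟨hv.integrable_sq, N ∪ {0}, hN0, ?_⟩, ?_, ?_⟩
  · filter_upwards [measure_eq_zero_iff_ae_notMem.1 hN0] with t htN ht
    have htpos : 0 < t := lt_of_le_of_ne ht fun h => htN (Or.inr h.symm)
    have hd := hderiv t htpos fun h => htN (Or.inl h)
    refine ⟨hd.differentiableAt, ?_⟩
    rw [hd.deriv]
    exact MemLp.coeFn_toLp _
  · have hf0 : (hfL 0).toLp (f 0) ∈ monotoneCone ρ₀ :=
      toLp_mem_monotoneCone (hfL 0) Filter.univ_mem fun x _ y _ hxy => by simpa [hfdef] using hxy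
    filter_upwards [(hY 0 le_rfl).2.1, (hfL 0).coeFn_toLp] with x h1 h2
    rw [← h1]
    simp only [hXc]
    rw [monoProj_of_mem hf0, h2]
    simp [hfdef]
  · intro s t hsN htN hs hst
    have hspos : 0 < s := lt_of_le_of_ne hs fun h => hsN (Or.inr h.symm)
    have htpos := hspos.trans_le hst
    rw [(hderiv s hspos fun h => hsN (Or.inl h)).deriv,
      (hderiv t htpos fun h => htN (Or.inl h)).deriv, hnorm (V s) _ ae_eq_rfl,
      hnorm (V t) _ ae_eq_rfl, hnorm _ _ hv.coeFn_toLp]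
    have h1 := norm_sq_sub_of_orthogonal hM hVM hVo hspos hst
    have h2 := norm_le_of_orthogonal hVM hVo hspos
    have h3 := sq_nonneg ‖V s - V t‖
    constructor <;> linarith
  · intro t ht y hy z hz hyz
    obtain ⟨hYc, -, S, hS, hm₁, hm₂⟩ := hY t ht
    have h := increment_bounds_on_support hS hYc (hwc t) hm₁ hm₂ hy hz hyz
    rw [hwsub] at h
    exact h
  · intro s t hs hst y hy z hz
    have ht := hs.trans_le hst
    obtain ⟨S, hS, h⟩ := hstick s t hs hst
    have hs' := (hY s hs.le).1
    have ht' := (hY t ht.le).1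
    have h := support_prop_of_ae hS
      (p := fun y z => s * |Y t y - Y t z| ≤ t * |Y s y - Y s z|)
      (isClosed_le (by fun_prop) (by fun_prop)) h y hy z hz
    rw [one_div_mul_eq_div, one_div_mul_eq_div, div_le_div_iff₀ ht hs]
    linarith
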